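/- **Setting.** Let $n\ge 0$ and $J\ge 1$ be integers, let $X\subseteq\mathbb R^n$ be nonempty, compact and convex, and let $F$ be an $\mathbb R^n$-valued map that is continuous on $X$ and monotone on $X$, i.e. $\langle F(x)-F(y),x-y\rangle\ge 0$ for all $x,y\in X$. For $j=1,\dots,J$ let $f_j$ be a real-valued convex function on a convex domain $D_j\subseteq\mathbb R^n$ with $X\subseteq \operatorname{int} D_j$. Assume Slater's condition: there is $\hat x\in X$ with $f_j(\hat x)<0$ for all $j$. Let $\mathcal X=\{x\in X: f_j(x)\le 0,\ j=1,\dots,J\}$ and $[u]_+=\max\{u,0\}$. **Samples.** On a probability space, let $\xi_0,\xi_1,\dots$ be independent and identically distributed, let $j_0,j_1,\dots$ be independent and uniformly distributed on $\{1,\dots,J\}$, and let the sequences $(\xi_k)$ and $(j_k)$ be independent of each other. Let $F(x,\xi)\in\mathbb R^n$ be a jointly measurable stochastic oracle such that, for some $\nu>0$, $\mathbb E[F(x,\xi_k)-F(x)]=0$ and $\mathbb E[\|F(x,\xi_k)-F(x)\|^2]\le\nu^2$ for every $x\in X$ and $k\ge 0$. **Algorithm (RLSA).** Let $\rho,\gamma>0$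 and put $\rho_0=\rho$, $\gamma_0=\gamma$, $t_0=1$ and, for $k\ge1$, $$\rho_k=\frac{\rho}{\sqrt{k+1}\,\log(k+1)},\qquad \gamma_k=\frac{\gamma}{\sqrt{k+1}\,\log(k+1)},\qquad t_k=\frac{1}{\sqrt{k+1}\,\log(k+1)} .$$ Start from $x_0\in X$ and $\lambda_0=0\in\mathbb R^J$. For $k=0,1,2,\dots$ set $$\lambda_{k+1}^{(j)}=\begin{cases}[\rho_k f_j(x_k)+\lambda_k^{(j)}]_+,& j=j_k,\\ \lambda_k^{(j)},& j\ne j_k,\end{cases}\qquad x_{k+1}=\Pi_X\!\left[x_k-\gamma_k\big(F(x_k,\xi_k)+\lambda_{k+1}^{(j_k)}g_k\big)\right],$$ where $\Pi_X$ is the Euclidean projection onto $X$ and $g_k\in\partial f_{j_k}(x_k)$ is a subgradient chosen as a measurable function of $\xi_0,j_0,\dots,\xi_k,j_k$. Let $\bar x_K=\big(\sum_{k=0}^K t_kx_k\big)/\big(\sum_{k=0}^K t_k\big)$. **Theorem.** There is a constant $C$, depending only on $X$, $F$, the functions $f_j$ (with their domains), $\nu$, $\rho$ and $\gamma$ (and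 not on $K$, on the samples or the oracle, on $x_0$, or on the choice of subgradients), such that for every $K\ge 1$ the random variables below are integrable and $$\mathbb E\Big[\sup_{x\in\mathcal X}F(x)^T(\bar x_K-x)\Big]\le C\,\frac{\log(K+1)}{\sqrt{K+2}},\qquad \mathbb E\Big[\frac1J\sum_{j=1}^J[f_j(\bar x_K)]_+\Big]\le C\,\frac{\log(K+1)}{\sqrt{K+2}} .$$ -/

import Mathlib

open MeasureTheory ProbabilityTheory
open scoped RealInnerProductSpace

noncomputable section

namespace RLSA

/-- The Euclidean space of dimension `n`. -/
abbrev Vec (n : ℕ) : Type := EuclideanSpace ℝ (Fin n)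

/-- The subdifferential at `x` of a function `φ` with effective domain `D`. -/
def subdifferential {n : ℕ} (D : Set (Vec n)) (φ : Vec n → ℝ) (x : Vec n) : Set (Vec n) :=
  {g | ∀ y ∈ D, φ x + ⟪g, y - x⟫ ≤ φ y}

/-- `p` is the Euclidean projection of `y` onto `X`. -/
def IsProjection {n : ℕ} (X : Set (Vec n)) (y p : Vec n) : Prop :=
  p ∈ X ∧ ∀ z ∈ X, ‖y - p‖ ≤ ‖y - z‖

/-- The feasible set `{x ∈ X | f_j(x) ≤ 0 for all j}`. -/
def feasible {n J : ℕ} (X : Set (Vec n)) (f : Fin J → Vec n → ℝ) : Set (Vec n) :=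
  {x | x ∈ X ∧ ∀ j, f j x ≤ 0}

/-- Assumptions on the constrained variational inequality. `D j` is the effective domain
of the convex function `f j`; the map `F` matters only on `X`. -/
structure ProblemAssumptions {n J : ℕ} (X : Set (Vec n)) (F : Vec n → Vec n)
    (D : Fin J → Set (Vec n)) (f : Fin J → Vec n → ℝ) : Prop where
  continuousOn : ContinuousOn F X
  monotone : ∀ x ∈ X, ∀ y ∈ X, 0 ≤ ⟪F x - F y, x - y⟫
  convex_f : ∀ j, ConvexOn ℝ (D j) (f j)
  subset_interior : ∀ j, X ⊆ interior (D j)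
  nonempty : X.Nonempty
  compact : IsCompact X
  convex : Convex ℝ X
  slater : ∃ x ∈ X, ∀ j, f j x < 0

/-- Assumptions on the samples: `ξ k` are i.i.d. with law `μ`, `j k` are i.i.d. uniform on the
`J` constraint indices, the two sequences are independent of each other, and `G x (ξ k)` is an
unbiased estimator of `F x` with variance at most `ν ^ 2`, for every `x ∈ X`. -/
structure SamplingAssumptions {n J : ℕ} {S Ω : Type*} [MeasurableSpace S] [MeasurableSpace Ω]
    (P : Measure Ω) (μ : Measure S) (X : Set (Vec n)) (F : Vec n → Vec n)
    (G : Vec n → S → Vec n) (ν : ℝ) (ξ : ℕ → Ω → S) (j : ℕ → Ω → Fin J) : Prop where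
  measurable_oracle : Measurable (Function.uncurry G)
  measurable_xi : ∀ k, Measurable (ξ k)
  measurable_index : ∀ k, Measurable (j k)
  law_xi : ∀ k, P.map (ξ k) = μ
  indep_xi : iIndepFun ξ P
  uniform_index : ∀ k i, P.real {ω | j k ω = i} = (J : ℝ)⁻¹
  indep_index : iIndepFun j P
  indep_xi_index : IndepFun (fun ω k => ξ k ω) (fun ω k => j k ω) P
  unbiased : ∀ x ∈ X, ∀ k, Integrable (fun ω => G x (ξ k ω) - F x) P ∧
    ∫ ω, (G x (ξ k ω) - F x) ∂P = 0
  variance_le : ∀ x ∈ X, ∀ k, Integrable (fun ω => ‖G x (ξ k ω) - F x‖ ^ 2) P ∧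
    ∫ ω, ‖G x (ξ k ω) - F x‖ ^ 2 ∂P ≤ ν ^ 2

/-- The sigma-algebra generated by the samples `ξ 0, j 0, …, ξ k, j k`. -/
@[reducible]
def history {J : ℕ} {S Ω : Type*} [MeasurableSpace S]
    (ξ : ℕ → Ω → S) (j : ℕ → Ω → Fin J) (k : ℕ) : MeasurableSpace Ω :=
  ⨆ i ∈ Set.Iic k,
    (MeasurableSpace.comap (ξ i) inferInstance ⊔ MeasurableSpace.comap (j i) inferInstance)

/-- The sequence `c` at `k = 0` and `c / (√(k+1) log(k+1))` for `k ≥ 1`. -/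
def stepsize (c : ℝ) (k : ℕ) : ℝ :=
  if k = 0 then c else c / (√((k : ℝ) + 1) * Real.log ((k : ℝ) + 1))

/-- `x`, `lam`, `g` are the primal iterates, dual iterates and chosen subgradients in a run of
the randomized Lagrangian stochastic approximation method, started at `x₀`. The subgradient of
step `k` may be any element of the subdifferential, chosen measurably from the samples drawn
so far. -/
structure IsRun {n J : ℕ} {S Ω : Type*} [MeasurableSpace S]
    (X : Set (Vec n)) (D : Fin J → Set (Vec n)) (f : Fin J → Vec n → ℝ)
    (G : Vec n → S → Vec n) (rho gam : ℕ → ℝ) (ξ : ℕ → Ω → S) (j : ℕ → Ω → Fin J)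
    (x₀ : Vec n) (x : ℕ → Ω → Vec n) (lam : ℕ → Ω → Fin J → ℝ) (g : ℕ → Ω → Vec n) :
    Prop where
  init_primal : ∀ ω, x 0 ω = x₀
  init_dual : ∀ ω i, lam 0 ω i = 0
  dual_step : ∀ k ω i, lam (k + 1) ω i =
    if i = j k ω then max (rho k * f i (x k ω) + lam k ω i) 0 else lam k ω i
  subgradient_mem : ∀ k ω, g k ω ∈ subdifferential (D (j k ω)) (f (j k ω)) (x k ω)
  subgradient_measurable : ∀ k, Measurable[history ξ j k] (g k)
  primal_step : ∀ k ω, IsProjection X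
    (x k ω - gam k • (G (x k ω) (ξ k ω) + lam (k + 1) ω (j k ω) • g k ω)) (x (k + 1) ω)

/-- The weighted average of `x 0, …, x K` with weights `t 0, …, t K`. -/
def weightedAverage {n : ℕ} (t : ℕ → ℝ) (x : ℕ → Vec n) (K : ℕ) : Vec n :=
  (∑ k ∈ Finset.range (K + 1), t k)⁻¹ • ∑ k ∈ Finset.range (K + 1), t k • x k

/-- The dual gap function `sup_{y ∈ Y} F(y)ᵀ(x - y)`. -/
def dualGap {n : ℕ} (Y : Set (Vec n)) (F : Vec n → Vec n) (x : Vec n) : ℝ :=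
  sSup ((fun y => ⟪F y, x - y⟫) '' Y)

/-- The mean constraint violation `J⁻¹ 1ᵀ[f(x)]₊`. -/
def infeasibility {n J : ℕ} (f : Fin J → Vec n → ℝ) (x : Vec n) : ℝ :=
  (J : ℝ)⁻¹ * ∑ j, max (f j x) 0

/-- The supremum in the dual gap is over a nonempty set that is bounded above. -/
theorem dualGap_isLUB {n J : ℕ} {X : Set (Vec n)} {F : Vec n → Vec n}
    {D : Fin J → Set (Vec n)} {f : Fin J → Vec n → ℝ} (h : ProblemAssumptions X F D f)
    (x : Vec n) :
    IsLUB ((fun y => ⟪F y, x - y⟫) '' feasible X f) (dualGap (feasible X f) F x) := by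
  apply isLUB_csSup
  · obtain ⟨z, hz, hf⟩ := h.slater
    exact ⟨_, z, ⟨hz, fun j => (hf j).le⟩, rfl⟩
  · have hc : ContinuousOn (fun y => ⟪F y, x - y⟫) X :=
      fun y hy => (h.continuousOn y hy).inner
        ((continuousOn_const.sub continuousOn_id) y hy)
    exact (h.compact.image_of_continuousOn hc).bddAbove.mono
      (Set.image_mono fun _ hy => hy.1)

end RLSA

end

/-! The primal and dual steps are fixed multiples of the averaging weight t_k = `stepsize 1 k`, so
the natural potential is V_k(y, l) = ‖x_k - y‖²/γ + ‖λ_k - l‖²/ρ (`energy`). For feasible y and l ≥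
0, one step gives V_{k+1} ≤ V_k - 2 t_k (⟨F(x_k), x_k - y⟩ + J⁻¹ ∑ l_i f_i(x_k)) + noise + γ t_k²
‖d_k‖², where d_k is the primal direction (`IsRun.energy_succ_le`). Both steps use the updated
multiplier, so the products λ_{k+1} f(x_k) cancel. The noise comes from the oracle and from the
sampled index, and for deterministic y and l it has mean zero.

The obstacle is that ‖d_k‖² involves the multipliers, which have no a priori bound. It is removed by
a Minty saddle point (y, l) of the Lagrangian (`ProblemAssumptions.exists_saddle`), obtained by
convex separation for finitely many test points and then by compactness, Slater's condition bounding
the multipliers. At (y, J l) the bracket is nonnegative, so E V_k obeys a Gronwall recursion with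
weights t_k². As ∑ t_k² converges, E‖λ_k‖² is bounded uniformly in k (`integral_dual_sq_le`).

For the gap, the energy inequality with l = 0 is summed and monotonicity replaces F(x_k) by F(y).
The supremum over y stands inside the expectation, but y meets the noise only through ⟨∑ t_k e_k,
y⟩, with e_k the oracle error; the e_k are orthogonal in L², so E‖∑ t_k e_k‖ is bounded. For
infeasibility, λ_{K+1}/ρ dominates the sum of the sampled values t_k f_i(x_k), which is J⁻¹ ∑ t_k
f_i(x_k) up to another orthogonal sum. Both errors multiplied by ∑ t_k are therefore bounded in
mean, and ∑ t_k grows at least like √K / log K. -/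

namespace RLSA

/-! ### Step sizes -/

theorem stepsize_eq_mul (c : ℝ) (k : ℕ) : stepsize c k = c * stepsize 1 k := by
  unfold stepsize
  split_ifs <;> ring

theorem stepsize_one_pos (k : ℕ) : 0 < stepsize 1 k := by
  unfold stepsize
  split_ifs with h
  · exact one_pos
  · have hk : (1 : ℝ) ≤ k := by exact_mod_cast Nat.one_le_iff_ne_zero.2 h
    have := Real.log_pos (x := (k : ℝ) + 1) (by linarith)
    positivity

/-- The square is 1/((k+1) log²(k+1)), and 1/(k+1) ≤ log(k+1) - log k. The restriction 2 ≤ k avoids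
log 1 = 0. -/
theorem stepsize_one_sq_le_telescope (k : ℕ) (hk : 2 ≤ k) :
    stepsize 1 k ^ 2 ≤ (Real.log k)⁻¹ - (Real.log (k + 1))⁻¹ := by
  have hk' : (2 : ℝ) ≤ k := by exact_mod_cast hk
  have h1 := Real.log_pos (x := (k : ℝ)) (by linarith)
  have h2 : Real.log k ≤ Real.log (k + 1) := Real.log_le_log (by linarith) (by linarith)
  have h3 : 1 / ((k : ℝ) + 1) ≤ Real.log (k + 1) - Real.log k := by
    rw [← Real.log_div (by positivity) (by positivity)]
    have := Real.one_sub_inv_le_log_of_pos (x := ((k : ℝ) + 1) / k) (by positivity)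
    refine le_trans (le_of_eq ?_) this
    field_simp
    ring
  have h4 : stepsize 1 k ^ 2 = 1 / ((k : ℝ) + 1) * (1 / Real.log (k + 1) ^ 2) := by
    rw [stepsize, if_neg (by omega), div_pow, mul_pow, Real.sq_sqrt (by positivity)]
    field_simp
  have h5 : (Real.log k)⁻¹ - (Real.log (k + 1))⁻¹ =
      (Real.log (k + 1) - Real.log k) * (1 / (Real.log k * Real.log (k + 1))) := by
    have : Real.log ((k : ℝ) + 1) ≠ 0 := by linarith
    field_simp
  rw [h4, h5]
  have h6 : Real.log k * Real.log (k + 1) ≤ Real.log (k + 1) ^ 2 := by nlinarith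
  have h7 : 0 < Real.log k * Real.log (k + 1) := by nlinarith
  exact mul_le_mul h3 (one_div_le_one_div_of_le h7 h6) (by positivity)
    (le_trans (by positivity) h3)

theorem exists_sum_stepsize_sq_le :
    ∃ S : ℝ, 0 ≤ S ∧ ∀ N : ℕ, ∑ k ∈ Finset.range N, stepsize 1 k ^ 2 ≤ S := by
  have key : ∀ m : ℕ, ∑ k ∈ Finset.range (m + 2), stepsize 1 k ^ 2 ≤
      stepsize 1 0 ^ 2 + stepsize 1 1 ^ 2 + (Real.log 2)⁻¹ - (Real.log ((m : ℝ) + 2))⁻¹ := by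
    intro m
    induction m with
    | zero => simp [Finset.sum_range_succ]
    | succ m ih =>
      rw [show m + 1 + 2 = (m + 2) + 1 by ring, Finset.sum_range_succ]
      have := stepsize_one_sq_le_telescope (m + 2) (by omega)
      push_cast at this ⊢
      rw [show (m : ℝ) + 1 + 2 = m + 2 + 1 by ring]
      linarith
  have hl : 0 ≤ (Real.log 2)⁻¹ := inv_nonneg.2 (Real.log_nonneg (by norm_num))
  refine ⟨stepsize 1 0 ^ 2 + stepsize 1 1 ^ 2 + (Real.log 2)⁻¹, by positivity, fun N => ?_⟩
  have h1 : ∑ k ∈ Finset.range N, stepsize 1 k ^ 2 ≤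
      ∑ k ∈ Finset.range (N + 2), stepsize 1 k ^ 2 :=
    Finset.sum_le_sum_of_subset_of_nonneg (Finset.range_mono (by omega))
      fun _ _ _ => sq_nonneg _
  have h2 : 0 ≤ (Real.log ((N : ℝ) + 2))⁻¹ := inv_nonneg.2 (Real.log_nonneg (by
    have : (0 : ℝ) ≤ N := N.cast_nonneg
    linarith))
  linarith [key N]

/-- Monotonicity fails at index 0: `stepsize 1 0` is 1, while `stepsize 1 1` = 1/(√2 log 2) exceeds
1. -/
theorem stepsize_one_le_of_le {k K : ℕ} (hk : 1 ≤ k) (h : k ≤ K) :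
    stepsize 1 K ≤ stepsize 1 k := by
  have hk' : (1 : ℝ) ≤ k := by exact_mod_cast hk
  have h' : (k : ℝ) ≤ K := by exact_mod_cast h
  rw [stepsize, stepsize, if_neg (by omega), if_neg (by omega)]
  have h1 := Real.log_pos (x := (k : ℝ) + 1) (by linarith)
  have h2 : Real.log (k + 1) ≤ Real.log (K + 1) := Real.log_le_log (by linarith) (by linarith)
  gcongr

theorem sum_stepsize_pos (K : ℕ) : 0 < ∑ k ∈ Finset.range (K + 1), stepsize 1 k :=
  Finset.sum_pos (fun k _ => stepsize_one_pos k) ⟨0, by simp⟩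

theorem inv_sum_stepsize_le (K : ℕ) (hK : 1 ≤ K) :
    (∑ k ∈ Finset.range (K + 1), stepsize 1 k)⁻¹ ≤
      3 * (Real.log ((K : ℝ) + 1) / √((K : ℝ) + 2)) := by
  have hK' : (1 : ℝ) ≤ K := by exact_mod_cast hK
  have hlog := Real.log_pos (x := (K : ℝ) + 1) (by linarith)
  -- The term of index 0 is dropped; each of the other K terms is at least the last one.
  have h1 : (K : ℝ) * stepsize 1 K ≤ ∑ k ∈ Finset.range (K + 1), stepsize 1 k := by
    rw [Finset.sum_range_succ']
    have : ∑ k ∈ Finset.range K, stepsize 1 K ≤ ∑ k ∈ Finset.range K, stepsize 1 (k + 1) :=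
      Finset.sum_le_sum fun k hk => stepsize_one_le_of_le (by omega)
        (by have := Finset.mem_range.1 hk; omega)
    simp only [Finset.sum_const, Finset.card_range, nsmul_eq_mul] at this
    linarith [stepsize_one_pos 0]
  have h2 : 0 < (K : ℝ) * stepsize 1 K := mul_pos (by linarith) (stepsize_one_pos K)
  refine (inv_anti₀ h2 h1).trans ?_
  rw [stepsize, if_neg (by omega)]
  -- The constant 3 comes from (K+1)(K+2) ≤ 9K² for K ≥ 1.
  have h3 : √((K : ℝ) + 1) * √((K : ℝ) + 2) ≤ 3 * K := by
    rw [← Real.sqrt_mul (by linarith)]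
    exact Real.sqrt_le_iff.2 ⟨by linarith, by nlinarith⟩
  have h4 : 0 < √((K : ℝ) + 2) := Real.sqrt_pos.2 (by linarith)
  have h5 : 0 < √((K : ℝ) + 1) := Real.sqrt_pos.2 (by linarith)
  have h6 : ((K : ℝ) * (1 / (√((K : ℝ) + 1) * Real.log ((K : ℝ) + 1))))⁻¹ =
      √((K : ℝ) + 1) * Real.log ((K : ℝ) + 1) / K := by
    field_simp
  rw [h6, ← mul_div_assoc, div_le_div_iff₀ (by linarith) h4]
  nlinarith

/-! ### Consequences of the problem assumptions -/

section Problem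

variable {n J : ℕ} {X : Set (Vec n)} {F : Vec n → Vec n} {D : Fin J → Set (Vec n)}
  {f : Fin J → Vec n → ℝ}

theorem ProblemAssumptions.continuousOn_f (h : ProblemAssumptions X F D f) (j : Fin J) :
    ContinuousOn (f j) X :=
  (h.convex_f j).continuousOn_interior.mono (h.subset_interior j)

theorem ProblemAssumptions.convexOn_f (h : ProblemAssumptions X F D f) (j : Fin J) :
    ConvexOn ℝ X (f j) :=
  (h.convex_f j).subset ((h.subset_interior j).trans interior_subset) h.convex

/-- Subgradients are uniformly bounded on compact subsets of the interior of the domain. -/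
theorem exists_norm_subgradient_le {C : Set (Vec n)} {φ : Vec n → ℝ} (hφ : ConvexOn ℝ C φ)
    (hX : IsCompact X) (hXC : X ⊆ interior C) :
    ∃ M : ℝ, ∀ x ∈ X, ∀ g ∈ subdifferential C φ x, ‖g‖ ≤ M := by
  obtain ⟨δ, hδ, hsub⟩ := hX.exists_cthickening_subset_open isOpen_interior hXC
  have hK : IsCompact (Metric.cthickening δ X) := hX.cthickening
  obtain ⟨B, hB⟩ := hK.exists_bound_of_continuousOn (hφ.continuousOn_interior.mono hsub)
  refine ⟨2 * B / δ, fun x hx g hg => ?_⟩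
  have hxB := hB x (Metric.self_subset_cthickening X hx)
  rcases eq_or_ne g 0 with rfl | hg0
  · rw [norm_zero]
    have : 0 ≤ B := (norm_nonneg _).trans hxB
    positivity
  have hgn : 0 < ‖g‖ := norm_pos_iff.2 hg0
  -- Moving a distance δ along g raises φ by at least δ‖g‖, while φ varies by at most 2B on the
  -- thickening.
  have hy : x + (δ / ‖g‖) • g ∈ Metric.cthickening δ X := by
    refine Metric.mem_cthickening_of_dist_le _ x δ X hx ?_
    rw [dist_eq_norm, add_sub_cancel_left, norm_smul, Real.norm_of_nonneg (by positivity),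
      div_mul_cancel₀ _ hgn.ne']
  have h1 := hg _ (interior_subset (hsub hy))
  have h2 := hB _ hy
  rw [add_sub_cancel_left, inner_smul_right, real_inner_self_eq_norm_sq] at h1
  have h3 : δ / ‖g‖ * ‖g‖ ^ 2 = δ * ‖g‖ := by field_simp
  rw [h3] at h1
  rw [Real.norm_eq_abs, abs_le] at hxB h2
  rw [le_div_iff₀ hδ]
  linarith

theorem ProblemAssumptions.exists_bound (h : ProblemAssumptions X F D f) :
    ∃ M : ℝ, 0 ≤ M ∧ (∀ x ∈ X, ‖x‖ ≤ M) ∧ (∀ x ∈ X, ‖F x‖ ≤ M) ∧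
      (∀ j, ∀ x ∈ X, |f j x| ≤ M) ∧ ∀ j, ∀ x ∈ X, ∀ g ∈ subdifferential (D j) (f j) x, ‖g‖ ≤ M := by
  obtain ⟨M₁, h₁⟩ := h.compact.exists_bound_of_continuousOn (f := id) continuousOn_id
  obtain ⟨M₂, h₂⟩ := h.compact.exists_bound_of_continuousOn h.continuousOn
  choose M₃ h₃ using fun j => h.compact.exists_bound_of_continuousOn (h.continuousOn_f j)
  choose M₄ h₄ using fun j =>
    exists_norm_subgradient_le (h.convex_f j) h.compact (h.subset_interior j)
  have h5 : ∀ j, |M₃ j| ≤ ∑ i, |M₃ i| := fun j =>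
    Finset.single_le_sum (f := fun i => |M₃ i|) (fun _ _ => abs_nonneg _) (Finset.mem_univ j)
  have h6 : ∀ j, |M₄ j| ≤ ∑ i, |M₄ i| := fun j =>
    Finset.single_le_sum (f := fun i => |M₄ i|) (fun _ _ => abs_nonneg _) (Finset.mem_univ j)
  have h7 : 0 ≤ ∑ i, |M₃ i| := Finset.sum_nonneg fun _ _ => abs_nonneg _
  have h8 : 0 ≤ ∑ i, |M₄ i| := Finset.sum_nonneg fun _ _ => abs_nonneg _
  refine ⟨|M₁| + |M₂| + ∑ j, |M₃ j| + ∑ j, |M₄ j|, by positivity, fun x hx => ?_, fun x hx => ?_,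
    fun j x hx => ?_, fun j x hx g hg => ?_⟩
  · have := h₁ x hx
    simp only [id] at this
    linarith [le_abs_self M₁, abs_nonneg M₂]
  · linarith [h₂ x hx, le_abs_self M₂, abs_nonneg M₁]
  · have := h₃ j x hx
    rw [Real.norm_eq_abs] at this
    linarith [le_abs_self (M₃ j), abs_nonneg M₁, abs_nonneg M₂, h5 j]
  · linarith [h₄ j x hx g hg, le_abs_self (M₄ j), abs_nonneg M₁, abs_nonneg M₂, h6 j]

/-! ### Euclidean projections -/

theorem IsProjection.inner_le_zero (hX : Convex ℝ X) {y p : Vec n} (hp : IsProjection X y p)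
    {z : Vec n} (hz : z ∈ X) : ⟪y - p, z - p⟫ ≤ 0 := by
  refine (norm_eq_iInf_iff_real_inner_le_zero hX hp.1).1 (le_antisymm ?_ ?_) z hz
  · have : Nonempty X := ⟨⟨p, hp.1⟩⟩
    exact le_ciInf fun w => hp.2 w w.2
  · exact ciInf_le (f := fun w : X => ‖y - w‖)
      ⟨0, Set.forall_mem_range.2 fun _ => norm_nonneg _⟩ ⟨p, hp.1⟩

theorem IsProjection.norm_sub_sq_le (hX : Convex ℝ X) {y p : Vec n} (hp : IsProjection X y p)
    {z : Vec n} (hz : z ∈ X) : ‖p - z‖ ^ 2 ≤ ‖y - z‖ ^ 2 := by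
  have h1 := hp.inner_le_zero hX hz
  have h2 : ‖y - z‖ ^ 2 = ‖y - p‖ ^ 2 - 2 * ⟪y - p, z - p⟫ + ‖z - p‖ ^ 2 := by
    rw [← norm_sub_sq_real]
    congr 2
    abel
  rw [h2, norm_sub_rev z p]
  nlinarith [sq_nonneg ‖y - p‖]

theorem IsProjection.norm_sub_le (hX : Convex ℝ X) {y p z q : Vec n} (hp : IsProjection X y p)
    (hq : IsProjection X z q) : ‖p - q‖ ≤ ‖y - z‖ := by
  have h1 := hp.inner_le_zero hX hq.1
  have h2 := hq.inner_le_zero hX hp.1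
  have h3 : ‖p - q‖ ^ 2 ≤ ⟪y - z, p - q⟫ := by
    have e : y - z = (p - q) + ((y - p) - (z - q)) := by abel
    rw [e, inner_add_left, real_inner_self_eq_norm_sq, inner_sub_left]
    have e2 : q - p = -(p - q) := by abel
    rw [e2, inner_neg_right] at h1
    linarith
  have h4 := real_inner_le_norm (y - z) (p - q)
  by_contra! hlt
  nlinarith [norm_nonneg (y - z), norm_nonneg (p - q)]

/-- A run only says that each iterate is some nearest point. Uniqueness and nonexpansiveness turn
this into a continuous map, from which measurability of the iterates follows. -/
theorem exists_continuous_projection (hX : Convex ℝ X) (hc : IsCompact X) (hne : X.Nonempty) :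
    ∃ π : Vec n → Vec n, Continuous π ∧ ∀ y p, IsProjection X y p → p = π y := by
  have hex : ∀ y, ∃ p, IsProjection X y p := fun y => by
    obtain ⟨p, hp, hmin⟩ := hc.exists_isMinOn hne
      (f := fun z => ‖y - z‖) (by fun_prop)
    exact ⟨p, hp, fun z hz => hmin hz⟩
  choose π hπ using hex
  refine ⟨π, ?_, fun y p hp => ?_⟩
  · refine (LipschitzWith.of_dist_le_mul (K := 1) fun y z => ?_).continuous
    rw [dist_eq_norm, dist_eq_norm, NNReal.coe_one, one_mul]
    exact (hπ y).norm_sub_le hX (hπ z)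
  · have := hp.norm_sub_le hX (hπ y)
    rw [sub_self, norm_zero] at this
    exact sub_eq_zero.1 (norm_le_zero_iff.1 this)

/-! ### A saddle point -/

/-- A convex set of vectors containing none with all coordinates below a positive number lies
in an open half space with nonnegative normal vector. -/
theorem exists_nonneg_weights {ι : Type*} [Fintype ι] {A : Set (ι → ℝ)} (hA : Convex ℝ A)
    {ε : ℝ} (hε : 0 < ε) (hA' : ∀ a ∈ A, ∃ i, ε ≤ a i) :
    ∃ p : ι → ℝ, (∀ i, 0 ≤ p i) ∧ ∀ a ∈ A, 0 < ∑ i, p i * a i := by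
  classical
  have hO : {a : ι → ℝ | ∀ i, a i < ε} = Set.univ.pi fun _ => Set.Iio ε := by
    ext a
    simp
  have hconv : Convex ℝ {a : ι → ℝ | ∀ i, a i < ε} := by
    rw [hO]
    exact convex_pi fun _ _ => convex_Iio ε
  have hopen : IsOpen {a : ι → ℝ | ∀ i, a i < ε} := by
    rw [hO]
    exact isOpen_set_pi Set.finite_univ fun _ _ => isOpen_Iio
  have hdisj : Disjoint {a : ι → ℝ | ∀ i, a i < ε} A := by
    rw [Set.disjoint_left]
    intro a ha haA
    obtain ⟨i, hi⟩ := hA' a haA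
    exact absurd (ha i) (not_lt.2 hi)
  obtain ⟨φ, u, h1, h2⟩ := geometric_hahn_banach_open hconv hopen hA hdisj
  have hφ : ∀ a : ι → ℝ, φ a = ∑ i, φ (Pi.single i 1) * a i := fun a => by
    conv_lhs => rw [pi_eq_sum_univ' a]
    rw [map_sum]
    refine Finset.sum_congr rfl fun i _ => ?_
    rw [map_smul, smul_eq_mul, mul_comm]
  -- The origin lies in the open set because ε > 0; this makes the final inequality strict.
  have hu : 0 < u := by
    have := h1 0 fun i => by simpa using hε
    simpa using this
  refine ⟨fun i => φ (Pi.single i 1), fun i => ?_, fun a ha => ?_⟩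
  · by_contra! hi
    -- If φ were negative on the i-th basis vector, this multiple would have no positive coordinate,
    -- hence lie in the open set, and φ would equal u there.
    have h3 := h1 ((u / φ (Pi.single i 1)) • Pi.single i 1) fun k => by
      have : u / φ (Pi.single i 1) ≤ 0 := div_nonpos_of_nonneg_of_nonpos hu.le hi.le
      by_cases hk : k = i
      · subst hk
        simp
        linarith
      · simpa [hk] using hε
    rw [map_smul, smul_eq_mul, div_mul_cancel₀ _ hi.ne] at h3
    exact lt_irrefl _ h3
  · rw [← hφ]
    exact hu.trans_le (h2 a ha)

/-- Symmetrizing the double sum in y and z turns each pair into a multiple of -⟨F y - F z, y - z⟩,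
which monotonicity makes nonpositive. -/
theorem ProblemAssumptions.weighted_sum_inner_le (h : ProblemAssumptions X F D f)
    (Y : Finset (Vec n)) (hY : ∀ y ∈ Y, y ∈ X) (p : Vec n → ℝ) (hp : ∀ y ∈ Y, 0 ≤ p y) :
    ∑ y ∈ Y, ∑ z ∈ Y, p y * p z * ⟪F y, z - y⟫ ≤ 0 := by
  have h1 : ∑ y ∈ Y, ∑ z ∈ Y, p y * p z * ⟪F y, z - y⟫ =
      ∑ y ∈ Y, ∑ z ∈ Y, p z * p y * ⟪F z, y - z⟫ := Finset.sum_comm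
  have h2 : ∑ y ∈ Y, ∑ z ∈ Y, p y * p z * ⟪F y, z - y⟫ +
      ∑ y ∈ Y, ∑ z ∈ Y, p z * p y * ⟪F z, y - z⟫ ≤ 0 := by
    rw [← Finset.sum_add_distrib]
    refine Finset.sum_nonpos fun y hy => ?_
    rw [← Finset.sum_add_distrib]
    refine Finset.sum_nonpos fun z hz => ?_
    have e : p y * p z * ⟪F y, z - y⟫ + p z * p y * ⟪F z, y - z⟫ =
        -(p y * p z * ⟪F y - F z, y - z⟫) := by
      rw [inner_sub_left, ← neg_sub y z, inner_neg_right]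
      ring
    rw [e]
    have := h.monotone y (hY y hy) z (hY z hz)
    have := mul_nonneg (mul_nonneg (hp y hy) (hp z hz)) this
    linarith
  linarith

/-- If no such pair exists, separation gives nonnegative weights under which a combination of all
the conditions is positive for every (x, l). Testing it at the barycentre of Y, for the weights on
Y, contradicts monotonicity. -/
theorem ProblemAssumptions.exists_approx_saddle (h : ProblemAssumptions X F D f)
    (Y : Finset (Vec n)) (hY : ∀ y ∈ Y, y ∈ X) {ε : ℝ} (hε : 0 < ε) :
    ∃ x ∈ X, ∃ l : Fin J → ℝ, (∀ j, 0 ≤ l j) ∧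
      (∀ y ∈ Y, ⟪F y, x - y⟫ - ∑ j, l j * f j y ≤ ε) ∧ ∀ j, f j x ≤ ε := by
  obtain ⟨w, hwX, hw⟩ := h.slater
  by_contra! hcon
  -- Vectors dominating the values of all conditions at some (x, l). Passing to upper bounds makes
  -- the set convex although the f j are only convex.
  let A : Set (Y ⊕ Fin J → ℝ) := {a | ∃ x ∈ X, ∃ l : Fin J → ℝ, (∀ j, 0 ≤ l j) ∧
    (∀ y : Y, ⟪F y, x - y⟫ - ∑ j, l j * f j y ≤ a (Sum.inl y)) ∧ ∀ j, f j x ≤ a (Sum.inr j)}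
  have hA : Convex ℝ A := by
    rintro a ⟨x, hx, l, hl, ha1, ha2⟩ b ⟨z, hz, m, hm, hb1, hb2⟩ s t hs ht hst
    refine ⟨s • x + t • z, h.convex hx hz hs ht hst, fun j => s * l j + t * m j,
      fun j => add_nonneg (mul_nonneg hs (hl j)) (mul_nonneg ht (hm j)), fun y => ?_, fun j => ?_⟩
    · have e1 : s • x + t • z - (y : Vec n) = s • (x - y) + t • (z - y) := by
        have : (y : Vec n) = s • (y : Vec n) + t • (y : Vec n) := by
          rw [← add_smul, hst, one_smul]
        rw [smul_sub, smul_sub]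
        nth_rw 1 [this]
        abel
      have e2 : ∑ j, (s * l j + t * m j) * f j y =
          s * ∑ j, l j * f j y + t * ∑ j, m j * f j y := by
        rw [Finset.mul_sum, Finset.mul_sum, ← Finset.sum_add_distrib]
        exact Finset.sum_congr rfl fun j _ => by ring
      rw [e1, e2, inner_add_right, inner_smul_right, inner_smul_right]
      simp only [Pi.add_apply, Pi.smul_apply, smul_eq_mul]
      have := mul_le_mul_of_nonneg_left (ha1 y) hs
      have := mul_le_mul_of_nonneg_left (hb1 y) ht
      linarith
    · have h1 := (h.convexOn_f j).2 hx hz hs ht hst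
      simp only [Pi.add_apply, Pi.smul_apply, smul_eq_mul] at h1 ⊢
      have := mul_le_mul_of_nonneg_left (ha2 j) hs
      have := mul_le_mul_of_nonneg_left (hb2 j) ht
      linarith
  obtain ⟨p, hp, hpos⟩ := exists_nonneg_weights hA hε fun a ⟨x, hx, l, hl, ha1, ha2⟩ => by
    by_contra! hlt
    obtain ⟨j, hj⟩ := hcon x hx l hl fun y hy => (ha1 ⟨y, hy⟩).trans (hlt _).le
    linarith [ha2 j, hlt (Sum.inr j)]
  have key : ∀ x ∈ X, ∀ l : Fin J → ℝ, (∀ j, 0 ≤ l j) →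
      0 < ∑ y : Y, p (Sum.inl y) * (⟪F y, x - y⟫ - ∑ j, l j * f j y) +
        ∑ j, p (Sum.inr j) * f j x := fun x hx l hl => by
    have := hpos (Sum.elim (fun y : Y => ⟪F y, x - y⟫ - ∑ j, l j * f j y) fun j => f j x)
      ⟨x, hx, l, hl, fun y => le_rfl, fun j => le_rfl⟩
    simpa using this
  have hq : ∀ x : Vec n, (∀ j, f j x ≤ 0) → ∑ j, p (Sum.inr j) * f j x ≤ 0 := fun x hx =>
    Finset.sum_nonpos fun j _ => mul_nonpos_of_nonneg_of_nonpos (hp _) (hx j)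
  set s : ℝ := ∑ y : Y, p (Sum.inl y) with hs
  have hs0 : 0 ≤ s := Finset.sum_nonneg fun _ _ => hp _
  rcases hs0.eq_or_lt with hs0 | hs0
  -- All weight sits on the constraints; the Slater point then gives a nonpositive combination.
  · have hz : ∀ y : Y, p (Sum.inl y) = 0 := fun y =>
      (Finset.sum_eq_zero_iff_of_nonneg fun y _ => hp (Sum.inl y)).1 hs0.symm y (Finset.mem_univ y)
    have := key w hwX 0 fun _ => le_rfl
    simp only [hz, zero_mul, Finset.sum_const_zero, zero_add] at this
    linarith [hq w fun j => (hw j).le]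
  have hwt : ∑ y : Y, p (Sum.inl y) / s = 1 := by
    rw [← Finset.sum_div, ← hs, div_self hs0.ne']
  have hwt0 : ∀ y : Y, 0 ≤ p (Sum.inl y) / s := fun y => div_nonneg (hp _) hs0.le
  set z : Vec n := ∑ y : Y, (p (Sum.inl y) / s) • (y : Vec n) with hz
  have hzX : z ∈ X := h.convex.sum_mem (fun y _ => hwt0 y) hwt fun y _ => hY y y.2
  -- Multipliers may be arbitrarily large, so the coefficient of each l j in the positive
  -- combination cannot have the wrong sign. By Jensen this makes z feasible.
  have hm : ∀ j, ∑ y : Y, p (Sum.inl y) * f j y ≤ 0 := by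
    intro j
    by_contra! hmj
    set m := ∑ y : Y, p (Sum.inl y) * f j y with hmdef
    set c := ∑ y : Y, p (Sum.inl y) * ⟪F y, w - y⟫ + ∑ j, p (Sum.inr j) * f j w with hc
    have hk : ∀ t : ℝ, 0 ≤ t → 0 < c - t * m := fun t ht => by
      have h1 := key w hwX (Pi.single j t) fun i => by
        by_cases hi : i = j
        · subst hi; simpa using ht
        · simp [hi]
      have h2 : ∀ y : Y, ∑ i, (Pi.single j t : Fin J → ℝ) i * f i y = t * f j y := fun y => by
        rw [Finset.sum_eq_single j]
        · simp
        · intro b _ hb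
          simp [hb]
        · simp
      simp only [h2, mul_sub, Finset.sum_sub_distrib] at h1
      have h3 : ∑ y : Y, p (Sum.inl y) * (t * f j y) = t * m := by
        rw [hmdef, Finset.mul_sum]
        exact Finset.sum_congr rfl fun y _ => by ring
      rw [h3] at h1
      linarith
    have hc0 := hk 0 le_rfl
    -- At t = c / m the supposedly positive quantity vanishes.
    have := hk (c / m) (div_nonneg (by linarith) hmj.le)
    rw [div_mul_cancel₀ _ hmj.ne', sub_self] at this
    exact lt_irrefl _ this
  have hfz : ∀ j, f j z ≤ 0 := fun j => by
    have h1 := (h.convexOn_f j).map_sum_le (t := Finset.univ) (fun y _ => hwt0 y) hwt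
      fun (y : Y) _ => hY y y.2
    have h2 : ∑ y : Y, (p (Sum.inl y) / s) • f j y = (∑ y : Y, p (Sum.inl y) * f j y) / s := by
      rw [Finset.sum_div]
      exact Finset.sum_congr rfl fun y _ => by rw [smul_eq_mul]; ring
    rw [h2] at h1
    exact h1.trans (div_nonpos_of_nonpos_of_nonneg (hm j) hs0.le)
  have h1 := key z hzX 0 fun _ => le_rfl
  simp only [Pi.zero_apply, zero_mul, Finset.sum_const_zero, sub_zero] at h1
  have h2 : 0 < ∑ y : Y, p (Sum.inl y) * ⟪F y, z - y⟫ := by linarith [hq z hfz]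
  classical
  let p' : Vec n → ℝ := fun y => if hy : y ∈ Y then p (Sum.inl ⟨y, hy⟩) else 0
  have h3 := h.weighted_sum_inner_le Y hY p' fun y hy => by simp only [p', dif_pos hy]; exact hp _
  have hp' : ∀ y : Y, p' y = p (Sum.inl y) := fun y => by simp [p']
  rw [← Finset.sum_coe_sort Y] at h3
  have h4 : ∑ y : Y, ∑ v ∈ Y, p' y * p' v * ⟪F y, v - y⟫ =
      s * ∑ y : Y, p (Sum.inl y) * ⟪F y, z - y⟫ := by
    rw [Finset.mul_sum]
    refine Finset.sum_congr rfl fun y _ => ?_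
    rw [← Finset.sum_coe_sort Y]
    have e : z - (y : Vec n) = ∑ v : Y, (p (Sum.inl v) / s) • ((v : Vec n) - y) := by
      simp only [smul_sub, Finset.sum_sub_distrib, ← Finset.sum_smul, hwt, one_smul, hz]
    rw [e, inner_sum, Finset.mul_sum, Finset.mul_sum]
    refine Finset.sum_congr rfl fun v _ => ?_
    rw [inner_smul_right, hp', hp']
    field_simp
  rw [h4] at h3
  exact absurd (mul_pos hs0 h2) (not_lt.2 h3)

/-- Existence of a feasible point and of multipliers that solve the Lagrangian form of the
variational inequality in the sense of Minty. -/
theorem ProblemAssumptions.exists_saddle (h : ProblemAssumptions X F D f) :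
    ∃ x ∈ X, ∃ l : Fin J → ℝ, (∀ j, 0 ≤ l j) ∧ (∀ j, f j x ≤ 0) ∧
      ∀ y ∈ X, 0 ≤ ⟪F y, y - x⟫ + ∑ j, l j * f j y := by
  obtain ⟨M, hM0, hMX, hMF, -, -⟩ := h.exists_bound
  obtain ⟨w, hwX, hw⟩ := h.slater
  -- Slater's condition confines the multipliers: ε ≤ 1 and |⟨F w, x - w⟩| ≤ M(2M) at the Slater
  -- point w bound every l j (-f j w).
  let K : Set (Vec n × (Fin J → ℝ)) :=
    X ×ˢ Set.univ.pi fun j => Set.Icc 0 ((1 + M * (2 * M)) / -f j w)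
  have hK : IsCompact K := h.compact.prod (isCompact_univ_pi fun j => isCompact_Icc)
  -- In the Minty form F is evaluated only at test points, so the first condition is affine in (x,
  -- l). Intersecting with X keeps the second one closed, `f j` being known to be continuous only on
  -- X.
  let T : X × ℕ → Set (Vec n × (Fin J → ℝ)) := fun i =>
    {q | ⟪F i.1, q.1 - i.1⟫ - ∑ j, q.2 j * f j i.1 ≤ 1 / ((i.2 : ℝ) + 1)} ∩
      ⋂ j, Prod.fst ⁻¹' (X ∩ f j ⁻¹' Set.Iic (1 / ((i.2 : ℝ) + 1)))
  have hT : ∀ i, IsClosed (T i) := fun i => by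
    refine IsClosed.inter (isClosed_le (by fun_prop) continuous_const)
      (isClosed_iInter fun j => IsClosed.preimage continuous_fst ?_)
    exact (h.continuousOn_f j).preimage_isClosed_of_isClosed h.compact.isClosed isClosed_Iic
  obtain ⟨⟨x, l⟩, ⟨hx, hl⟩, hxl⟩ := hK.inter_iInter_nonempty T hT fun u => by
    classical
    let N := u.sup Prod.snd
    have hN1 : 1 / ((N : ℝ) + 1) ≤ 1 := by
      rw [div_le_one (by positivity)]
      linarith [(N.cast_nonneg : (0 : ℝ) ≤ N)]
    have hN : ∀ i ∈ u, 1 / ((N : ℝ) + 1) ≤ 1 / ((i.2 : ℝ) + 1) := fun i hi => by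
      have : ((i.2 : ℕ) : ℝ) ≤ N := by exact_mod_cast Finset.le_sup (f := Prod.snd) hi
      gcongr
    -- The Slater point joins the test points so that the approximate saddle point lies in K.
    obtain ⟨x, hx, l, hl, h1, h2⟩ := h.exists_approx_saddle
      (insert w (u.image fun i => (i.1 : Vec n))) (by
        intro y hy
        rcases Finset.mem_insert.1 hy with rfl | hy
        · exact hwX
        · obtain ⟨i, -, rfl⟩ := Finset.mem_image.1 hy
          exact i.1.2) (ε := 1 / ((N : ℝ) + 1)) (by positivity)
    refine ⟨(x, l), ⟨hx, fun j _ => ⟨hl j, ?_⟩⟩, Set.mem_iInter₂.2 fun i hi => ⟨?_, ?_⟩⟩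
    · have h3 := h1 w (Finset.mem_insert_self _ _)
      rw [le_div_iff₀ (by linarith [hw j])]
      have h4 : l j * -f j w ≤ ∑ i, l i * -f i w :=
        Finset.single_le_sum (f := fun i => l i * -f i w)
          (fun i _ => mul_nonneg (hl i) (by linarith [hw i])) (Finset.mem_univ j)
      simp only [mul_neg, Finset.sum_neg_distrib] at h4 ⊢
      have h5 : |⟪F w, x - w⟫| ≤ M * (2 * M) :=
        (abs_real_inner_le_norm _ _).trans (mul_le_mul (hMF w hwX)
          ((norm_sub_le _ _).trans (by linarith [hMX x hx, hMX w hwX])) (norm_nonneg _) hM0)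
      have := (abs_le.1 h5).1
      linarith
    · exact (h1 _ (Finset.mem_insert_of_mem (Finset.mem_image_of_mem _ hi))).trans (hN i hi)
    · exact Set.mem_iInter.2 fun j => ⟨hx, (h2 j).trans (hN i hi)⟩
  have hlim := tendsto_one_div_add_atTop_nhds_zero_nat (𝕜 := ℝ)
  have hmem : ∀ i, (x, l) ∈ T i := Set.mem_iInter.1 hxl
  refine ⟨x, hx, l, fun j => (hl j (Set.mem_univ j)).1, fun j => ?_, fun y hy => ?_⟩
  · exact ge_of_tendsto' hlim fun m => (Set.mem_iInter.1 (hmem (⟨w, hwX⟩, m)).2 j).2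
  · have h1 : ⟪F y, x - y⟫ - ∑ j, l j * f j y ≤ 0 :=
      ge_of_tendsto' hlim fun m => (hmem (⟨y, hy⟩, m)).1
    rw [← neg_sub x y, inner_neg_right]
    linarith

/-! ### Regularity of the two error measures -/

/-- A supremum of affine functions with slopes bounded by M is M-Lipschitz. The resulting continuity
yields measurability of the gap. -/
theorem ProblemAssumptions.dualGap_sub_le (h : ProblemAssumptions X F D f) {M : ℝ}
    (hM : ∀ x ∈ X, ‖F x‖ ≤ M) (x z : Vec n) :
    dualGap (feasible X f) F x - dualGap (feasible X f) F z ≤ M * ‖x - z‖ := by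
  rw [sub_le_iff_le_add]
  refine (dualGap_isLUB h x).2 ?_
  rintro _ ⟨y, hy, rfl⟩
  have h1 : ⟪F y, z - y⟫ ≤ dualGap (feasible X f) F z := (dualGap_isLUB h z).1 ⟨y, hy, rfl⟩
  have h2 : ⟪F y, x - z⟫ ≤ M * ‖x - z‖ :=
    (real_inner_le_norm _ _).trans (mul_le_mul_of_nonneg_right (hM y hy.1) (norm_nonneg _))
  have h3 : ⟪F y, x - y⟫ = ⟪F y, x - z⟫ + ⟪F y, z - y⟫ := by
    rw [← inner_add_right, sub_add_sub_cancel]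
  simp only [h3]
  linarith

theorem ProblemAssumptions.continuous_dualGap (h : ProblemAssumptions X F D f) :
    Continuous (dualGap (feasible X f) F) := by
  obtain ⟨M, hM0, -, hMF, -, -⟩ := h.exists_bound
  refine (LipschitzWith.of_dist_le_mul (K := ⟨M, hM0⟩) fun x z => ?_).continuous
  rw [Real.dist_eq, dist_eq_norm, abs_le]
  constructor
  · have := h.dualGap_sub_le hMF z x
    rw [norm_sub_rev] at this
    change -(M * ‖x - z‖) ≤ _
    linarith
  · exact h.dualGap_sub_le hMF x z

theorem ProblemAssumptions.continuousOn_infeasibility (h : ProblemAssumptions X F D f) :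
    ContinuousOn (infeasibility f) X := by
  unfold infeasibility
  exact continuousOn_const.mul (continuousOn_finsetSum _ fun j _ =>
    (h.continuousOn_f j).sup continuousOn_const)

end Problem

/-! ### Independence of the samples from the past -/

section Past

variable {J : ℕ} {S Ω : Type*} [MeasurableSpace S]

/-- The sigma-algebra generated by the samples drawn before step `k`. -/
@[reducible]
def past (ξ : ℕ → Ω → S) (j : ℕ → Ω → Fin J) (k : ℕ) : MeasurableSpace Ω :=
  ⨆ i ∈ Set.Iio k,
    (MeasurableSpace.comap (ξ i) inferInstance ⊔ MeasurableSpace.comap (j i) inferInstance)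

variable {ξ : ℕ → Ω → S} {j : ℕ → Ω → Fin J}

theorem history_eq_past (k : ℕ) : history ξ j k = past ξ j (k + 1) := by
  have : Set.Iic k = Set.Iio (k + 1) := by
    ext i
    simp
  rw [history, past, this]

theorem past_mono {k l : ℕ} (h : k ≤ l) : past ξ j k ≤ past ξ j l :=
  biSup_mono fun _ hi => lt_of_lt_of_le hi h

theorem past_le [MeasurableSpace Ω] (hξ : ∀ k, Measurable (ξ k)) (hj : ∀ k, Measurable (j k)) (k : ℕ) :
    past ξ j k ≤ ‹MeasurableSpace Ω› :=
  iSup₂_le fun i _ => sup_le (hξ i).comap_le (hj i).comap_le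

theorem measurable_xi_past (k : ℕ) : Measurable[past ξ j (k + 1)] (ξ k) :=
  measurable_iff_comap_le.2 (le_sup_left.trans
    (le_iSup₂ (f := fun i (_ : i ∈ Set.Iio (k + 1)) => MeasurableSpace.comap (ξ i) inferInstance ⊔
      MeasurableSpace.comap (j i) inferInstance) k (Nat.lt_succ_self k)))

theorem measurable_index_past (k : ℕ) : Measurable[past ξ j (k + 1)] (j k) :=
  measurable_iff_comap_le.2 (le_sup_right.trans
    (le_iSup₂ (f := fun i (_ : i ∈ Set.Iio (k + 1)) => MeasurableSpace.comap (ξ i) inferInstance ⊔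
      MeasurableSpace.comap (j i) inferInstance) k (Nat.lt_succ_self k)))

/-- The sigma-algebras generated by the individual samples of both kinds. -/
@[reducible]
def sampleAlgebra (ξ : ℕ → Ω → S) (j : ℕ → Ω → Fin J) : ℕ ⊕ ℕ → MeasurableSpace Ω :=
  Sum.elim (fun i => MeasurableSpace.comap (ξ i) inferInstance)
    fun i => MeasurableSpace.comap (j i) inferInstance

/-- A finite intersection splits into a cylinder event of each sequence. Independence of the two
sequences separates these, and independence within each sequence factors them. -/
theorem iIndep_sampleAlgebra [MeasurableSpace Ω] {P : Measure Ω} (hξ : iIndepFun ξ P) (hj : iIndepFun j P)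
    (hξj : IndepFun (fun ω k => ξ k ω) (fun ω k => j k ω) P) :
    iIndep (sampleAlgebra ξ j) P := by
  classical
  refine (iIndep_iff _ _).2 fun s A hA => ?_
  have h1 : ∀ i, ∃ B : Set S, MeasurableSet B ∧ (Sum.inl i ∈ s → ξ i ⁻¹' B = A (Sum.inl i)) :=
    fun i => by
      by_cases hi : Sum.inl i ∈ s
      · obtain ⟨B, hB, h⟩ := hA _ hi
        exact ⟨B, hB, fun _ => h⟩
      · exact ⟨∅, MeasurableSet.empty, fun h => absurd h hi⟩
  have h2 : ∀ i, ∃ B : Set (Fin J), MeasurableSet B ∧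
      (Sum.inr i ∈ s → j i ⁻¹' B = A (Sum.inr i)) :=
    fun i => by
      by_cases hi : Sum.inr i ∈ s
      · obtain ⟨B, hB, h⟩ := hA _ hi
        exact ⟨B, hB, fun _ => h⟩
      · exact ⟨∅, MeasurableSet.empty, fun h => absurd h hi⟩
  choose B hB hBA using h1
  choose C hC hCA using h2
  have hinter : (⋂ i ∈ s, A i) = (fun ω k => ξ k ω) ⁻¹' (⋂ i ∈ s.toLeft, (fun u : ℕ → S => u i) ⁻¹' B i) ∩
      (fun ω k => j k ω) ⁻¹' (⋂ i ∈ s.toRight, (fun u : ℕ → Fin J => u i) ⁻¹' C i) := by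
    ext ω
    simp only [Set.mem_iInter, Set.mem_inter_iff, Set.mem_preimage,
      Finset.mem_toLeft, Finset.mem_toRight, Sum.forall]
    refine and_congr (forall₂_congr fun i hi => ?_) (forall₂_congr fun i hi => ?_)
    · rw [← hBA i hi]; rfl
    · rw [← hCA i hi]; rfl
  rw [hinter, hξj.measure_inter_preimage_eq_mul _ _
    (Finset.measurableSet_biInter _ fun i _ => measurable_pi_apply i (hB i))
    (Finset.measurableSet_biInter _ fun i _ => measurable_pi_apply i (hC i))]
  have e1 : (fun ω k => ξ k ω) ⁻¹' (⋂ i ∈ s.toLeft, (fun u : ℕ → S => u i) ⁻¹' B i) =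
      ⋂ i ∈ s.toLeft, ξ i ⁻¹' B i := by
    ext ω; simp
  have e2 : (fun ω k => j k ω) ⁻¹' (⋂ i ∈ s.toRight, (fun u : ℕ → Fin J => u i) ⁻¹' C i) =
      ⋂ i ∈ s.toRight, j i ⁻¹' C i := by
    ext ω; simp
  rw [e1, e2, hξ.measure_inter_preimage_eq_mul _ fun i _ => hB i,
    hj.measure_inter_preimage_eq_mul _ fun i _ => hC i]
  conv_rhs => rw [← Finset.toLeft_disjSum_toRight (u := s), Finset.prod_disjSum]
  congr 1
  · exact Finset.prod_congr rfl fun i hi => by rw [hBA i (Finset.mem_toLeft.1 hi)]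
  · exact Finset.prod_congr rfl fun i hi => by rw [hCA i (Finset.mem_toRight.1 hi)]

theorem indep_past_sample [MeasurableSpace Ω] {P : Measure Ω}
    (hξm : ∀ k, Measurable (ξ k)) (hjm : ∀ k, Measurable (j k))
    (hξ : iIndepFun ξ P) (hj : iIndepFun j P)
    (hξj : IndepFun (fun ω k => ξ k ω) (fun ω k => j k ω) P) (k : ℕ) (a : ℕ ⊕ ℕ)
    (ha : a = Sum.inl k ∨ a = Sum.inr k) : Indep (past ξ j k) (sampleAlgebra ξ j a) P := by
  have hle : ∀ i, sampleAlgebra ξ j i ≤ ‹MeasurableSpace Ω› := by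
    rintro (i | i)
    · exact (hξm i).comap_le
    · exact (hjm i).comap_le
  have hdisj : Disjoint {i : ℕ ⊕ ℕ | Sum.elim id id i < k} {a} := by
    rw [Set.disjoint_singleton_right]
    rcases ha with rfl | rfl <;> simp
  have := indep_iSup_of_disjoint hle (iIndep_sampleAlgebra hξ hj hξj) hdisj
  rw [iSup_singleton] at this
  refine indep_of_indep_of_le_left this (iSup₂_le fun i hi => sup_le ?_ ?_)
  · exact le_iSup₂ (f := fun b (_ : b ∈ {i : ℕ ⊕ ℕ | Sum.elim id id i < k}) =>
      sampleAlgebra ξ j b) (Sum.inl i) hi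
  · exact le_iSup₂ (f := fun b (_ : b ∈ {i : ℕ ⊕ ℕ | Sum.elim id id i < k}) =>
      sampleAlgebra ξ j b) (Sum.inr i) hi

end Past

/-! ### Integration against an independent variable -/

section Freeze

variable {Ω α S : Type*} [MeasurableSpace Ω] [MeasurableSpace α] [MeasurableSpace S]
  {P : Measure Ω} [IsProbabilityMeasure P] {U : Ω → α} {ξ : Ω → S}

/-- Fubini for the product law takes the place of conditional expectation. The mean must vanish for
every u; since the oracle is unbiased only on X, its error will be extended by zero. -/
theorem integral_comp_eq_zero_of_indepFun (hU : Measurable U) (hξ : Measurable ξ)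
    (hind : IndepFun U ξ P) {h : α × S → ℝ} (hh : Measurable h)
    (hint : Integrable (fun ω => h (U ω, ξ ω)) P) (hzero : ∀ u, ∫ ω, h (u, ξ ω) ∂P = 0) :
    ∫ ω, h (U ω, ξ ω) ∂P = 0 := by
  have hp : Measurable fun ω => (U ω, ξ ω) := hU.prodMk hξ
  have hmap := hind.map_prod_eq_prod_map_map hU.aemeasurable hξ.aemeasurable
  have hpU := Measure.isProbabilityMeasure_map (μ := P) hU.aemeasurable
  have hpξ := Measure.isProbabilityMeasure_map (μ := P) hξ.aemeasurable
  have h1 : Integrable h ((P.map U).prod (P.map ξ)) := by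
    rw [← hmap]
    exact (integrable_map_measure hh.aestronglyMeasurable hp.aemeasurable).2 hint
  rw [← integral_map (φ := fun ω => (U ω, ξ ω)) hp.aemeasurable hh.aestronglyMeasurable, hmap,
    integral_prod _ h1]
  refine integral_eq_zero_of_ae (Filter.Eventually.of_forall fun u => ?_)
  change ∫ s, h (u, s) ∂(P.map ξ) = 0
  have hhu : Measurable fun s => h (u, s) := hh.comp measurable_prodMk_left
  rw [integral_map hξ.aemeasurable hhu.aestronglyMeasurable]
  exact hzero u

/-- The nonnegative version presupposes no integrability, so it can be used to establish square
integrability of the noise. -/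
theorem lintegral_comp_le_of_indepFun (hU : Measurable U) (hξ : Measurable ξ)
    (hind : IndepFun U ξ P) {h : α × S → ENNReal} (hh : Measurable h) {c : ENNReal}
    (hle : ∀ u, ∫⁻ ω, h (u, ξ ω) ∂P ≤ c) : ∫⁻ ω, h (U ω, ξ ω) ∂P ≤ c := by
  have hp : Measurable fun ω => (U ω, ξ ω) := hU.prodMk hξ
  have hmap := hind.map_prod_eq_prod_map_map hU.aemeasurable hξ.aemeasurable
  have hpU := Measure.isProbabilityMeasure_map (μ := P) hU.aemeasurable
  have hpξ := Measure.isProbabilityMeasure_map (μ := P) hξ.aemeasurable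
  rw [← lintegral_map (g := fun ω => (U ω, ξ ω)) hh hp, hmap, lintegral_prod _ hh.aemeasurable]
  calc ∫⁻ u, ∫⁻ s, h (u, s) ∂(P.map ξ) ∂(P.map U) ≤ ∫⁻ _, c ∂(P.map U) := by
        refine lintegral_mono fun u => ?_
        have hhu : Measurable fun s => h (u, s) := hh.comp measurable_prodMk_left
        rw [lintegral_map hhu hξ]
        exact hle u
    _ = c := by simp

end Freeze

/-! ### Weighted sums of orthogonal increments -/

section Increments

variable {Ω E : Type*} [MeasurableSpace Ω] {P : Measure Ω}
  [NormedAddCommGroup E]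

theorem integrable_inner_of_memLp_two [InnerProductSpace ℝ E] {Y Z : Ω → E} (hY : MemLp Y 2 P)
    (hZ : MemLp Z 2 P) : Integrable (fun ω => ⟪Y ω, Z ω⟫) P :=
  (MemLp.integrable_mul hY.norm hZ.norm).mono'
    (hY.aestronglyMeasurable.inner hZ.aestronglyMeasurable)
    (Filter.Eventually.of_forall fun _ => norm_inner_le_norm _ _)

theorem integral_norm_sum_sq_le [InnerProductSpace ℝ E] {Z : ℕ → Ω → E} (hZ : ∀ k, MemLp (Z k) 2 P) {t : ℕ → ℝ} {c : ℝ}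
    (hc : ∀ k, ∫ ω, ‖Z k ω‖ ^ 2 ∂P ≤ c)
    (horth : ∀ k, ∫ ω, ⟪∑ i ∈ Finset.range k, t i • Z i ω, Z k ω⟫ ∂P = 0) (N : ℕ) :
    ∫ ω, ‖∑ i ∈ Finset.range N, t i • Z i ω‖ ^ 2 ∂P ≤ c * ∑ i ∈ Finset.range N, t i ^ 2 := by
  have hS : ∀ N, MemLp (fun ω => ∑ i ∈ Finset.range N, t i • Z i ω) 2 P := fun N =>
    memLp_finsetSum _ fun i _ => (hZ i).const_smul (t i)
  induction N with
  | zero => simp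
  | succ N ih =>
    have e : ∀ ω, ‖∑ i ∈ Finset.range (N + 1), t i • Z i ω‖ ^ 2 =
        ‖∑ i ∈ Finset.range N, t i • Z i ω‖ ^ 2 +
          2 * t N * ⟪∑ i ∈ Finset.range N, t i • Z i ω, Z N ω⟫ + t N ^ 2 * ‖Z N ω‖ ^ 2 := by
      intro ω
      rw [Finset.sum_range_succ, norm_add_sq_real, inner_smul_right, norm_smul, mul_pow,
        Real.norm_eq_abs, sq_abs]
      ring
    have i1 := (hS N).integrable_norm_pow two_ne_zero
    have i2 := (integrable_inner_of_memLp_two (hS N) (hZ N)).const_mul (2 * t N)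
    have i3 := ((hZ N).integrable_norm_pow two_ne_zero).const_mul (t N ^ 2)
    have i12 : Integrable (fun ω => ‖∑ i ∈ Finset.range N, t i • Z i ω‖ ^ 2 +
        2 * t N * ⟪∑ i ∈ Finset.range N, t i • Z i ω, Z N ω⟫) P := i1.add i2
    simp only [e]
    rw [integral_add i12 i3, integral_add i1 i2, integral_const_mul, integral_const_mul,
      horth N, Finset.sum_range_succ, mul_add]
    have := mul_le_mul_of_nonneg_left (hc N) (sq_nonneg (t N))
    linarith

theorem integral_norm_le_of_sq_le [IsProbabilityMeasure P] {Z : Ω → E} (hZ : MemLp Z 2 P) {c : ℝ}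
    (hc : ∫ ω, ‖Z ω‖ ^ 2 ∂P ≤ c) : ∫ ω, ‖Z ω‖ ∂P ≤ 1 + c := by
  have i1 := hZ.integrable_norm_pow two_ne_zero
  calc ∫ ω, ‖Z ω‖ ∂P ≤ ∫ ω, (1 + ‖Z ω‖ ^ 2) ∂P := by
        refine integral_mono (hZ.integrable one_le_two).norm ((integrable_const _).add i1)
          fun ω => ?_
        change ‖Z ω‖ ≤ 1 + ‖Z ω‖ ^ 2
        -- The cheap bound s ≤ 1 + s² suffices, as only boundedness is needed.
        nlinarith [sq_nonneg (‖Z ω‖ - 1)]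
    _ = 1 + ∫ ω, ‖Z ω‖ ^ 2 ∂P := by
        rw [integral_add (integrable_const _) i1]
        simp
    _ ≤ 1 + c := by linarith

end Increments

/-! ### The oracle error as a function on the whole space -/

section OracleError

variable {n : ℕ} {S : Type*} {X : Set (Vec n)} {F : Vec n → Vec n} {G : Vec n → S → Vec n}

/-- The oracle error, as a function of the point and the sample, extended by zero off `X`. -/
noncomputable def oracleError (X : Set (Vec n)) (F : Vec n → Vec n) (G : Vec n → S → Vec n)
    (p : Vec n × S) : Vec n :=
  (X ×ˢ Set.univ).indicator (fun p => G p.1 p.2 - X.indicator F p.1) p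

theorem oracleError_of_mem {y : Vec n} (hy : y ∈ X) (s : S) :
    oracleError X F G (y, s) = G y s - F y := by
  simp [oracleError, hy]

theorem oracleError_of_notMem {y : Vec n} (hy : y ∉ X) (s : S) :
    oracleError X F G (y, s) = 0 := by
  simp [oracleError, hy]

end OracleError

/-! ### Runs of the method: pathwise estimates -/

section Pathwise

variable {n J : ℕ} {S Ω : Type*} [MeasurableSpace S] {X : Set (Vec n)} {F : Vec n → Vec n}
  {D : Fin J → Set (Vec n)} {f : Fin J → Vec n → ℝ} {G : Vec n → S → Vec n} {ρ γ : ℝ}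
  {ξ : ℕ → Ω → S} {j : ℕ → Ω → Fin J} {x₀ : Vec n} {x : ℕ → Ω → Vec n}
  {lam : ℕ → Ω → Fin J → ℝ} {g : ℕ → Ω → Vec n}

/-- The error of the stochastic oracle at step `k`. -/
noncomputable def noise (F : Vec n → Vec n) (G : Vec n → S → Vec n) (ξ : ℕ → Ω → S)
    (x : ℕ → Ω → Vec n) (k : ℕ) (ω : Ω) : Vec n :=
  G (x k ω) (ξ k ω) - F (x k ω)

/-- The error made at step `k` by sampling the `i`-th constraint instead of averaging. -/
noncomputable def indexNoise (f : Fin J → Vec n → ℝ) (j : ℕ → Ω → Fin J) (x : ℕ → Ω → Vec n)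
    (i : Fin J) (k : ℕ) (ω : Ω) : ℝ :=
  ((if j k ω = i then 1 else 0) - (J : ℝ)⁻¹) * f i (x k ω)

/-- The weighted squared distance of the iterates of step `k` from a primal-dual pair. -/
noncomputable def energy (ρ γ : ℝ) (x : ℕ → Ω → Vec n) (lam : ℕ → Ω → Fin J → ℝ) (y : Vec n)
    (l : Fin J → ℝ) (k : ℕ) (ω : Ω) : ℝ :=
  ‖x k ω - y‖ ^ 2 / γ + (∑ i, (lam k ω i - l i) ^ 2) / ρ

theorem IsRun.mem {rho gam : ℕ → ℝ} (hr : IsRun X D f G rho gam ξ j x₀ x lam g) (hx₀ : x₀ ∈ X)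
    (k : ℕ) (ω : Ω) : x k ω ∈ X := by
  cases k with
  | zero => rw [hr.init_primal]; exact hx₀
  | succ k => exact (hr.primal_step k ω).1

theorem IsRun.lam_nonneg {rho gam : ℕ → ℝ} (hr : IsRun X D f G rho gam ξ j x₀ x lam g)
    (k : ℕ) (ω : Ω) (i : Fin J) : 0 ≤ lam k ω i := by
  induction k with
  | zero => rw [hr.init_dual]
  | succ k ih =>
    rw [hr.dual_step]
    split_ifs
    · exact le_max_right _ _
    · exact ih

/-- The linear term is taken at the new value, which absorbs the second order term a² and later
cancels the multiplier term of the primal step. -/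
theorem max_sub_sq_le (a b l : ℝ) (hl : 0 ≤ l) :
    (max (a + b) 0 - l) ^ 2 ≤ (b - l) ^ 2 + 2 * a * (max (a + b) 0 - l) := by
  rcases le_total (a + b) 0 with h | h
  · rw [max_eq_right h]
    nlinarith [mul_nonneg hl (neg_nonneg.2 h), sq_nonneg b]
  · rw [max_eq_left h]
    nlinarith [sq_nonneg a]

theorem IsRun.sum_dual_sq_le {rho gam : ℕ → ℝ} (hr : IsRun X D f G rho gam ξ j x₀ x lam g)
    (k : ℕ) (ω : Ω) {l : Fin J → ℝ} (hl : ∀ i, 0 ≤ l i) :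
    ∑ i, (lam (k + 1) ω i - l i) ^ 2 ≤ ∑ i, (lam k ω i - l i) ^ 2 +
      2 * (rho k * f (j k ω) (x k ω)) * (lam (k + 1) ω (j k ω) - l (j k ω)) := by
  rw [← Finset.add_sum_erase _ _ (Finset.mem_univ (j k ω)),
    ← Finset.add_sum_erase _ (fun i => (lam k ω i - l i) ^ 2) (Finset.mem_univ (j k ω))]
  have h1 : ∑ i ∈ Finset.univ.erase (j k ω), (lam (k + 1) ω i - l i) ^ 2 =
      ∑ i ∈ Finset.univ.erase (j k ω), (lam k ω i - l i) ^ 2 :=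
    Finset.sum_congr rfl fun i hi => by
      rw [hr.dual_step, if_neg (Finset.ne_of_mem_erase hi)]
  have h2 := max_sub_sq_le (rho k * f (j k ω) (x k ω)) (lam k ω (j k ω)) (l (j k ω)) (hl _)
  have h3 : lam (k + 1) ω (j k ω) = max (rho k * f (j k ω) (x k ω) + lam k ω (j k ω)) 0 := by
    rw [hr.dual_step, if_pos rfl]
  rw [h1, h3]
  linarith

theorem IsRun.norm_primal_sq_le (hprob : ProblemAssumptions X F D f) {rho gam : ℕ → ℝ}
    (hr : IsRun X D f G rho gam ξ j x₀ x lam g) (hgam : ∀ k, 0 < gam k) (k : ℕ) (ω : Ω)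
    {y : Vec n} (hy : y ∈ X) :
    ‖x (k + 1) ω - y‖ ^ 2 ≤ ‖x k ω - y‖ ^ 2 - 2 * gam k * (⟪G (x k ω) (ξ k ω), x k ω - y⟫ +
      lam (k + 1) ω (j k ω) * (f (j k ω) (x k ω) - f (j k ω) y)) +
      gam k ^ 2 * ‖G (x k ω) (ξ k ω) + lam (k + 1) ω (j k ω) • g k ω‖ ^ 2 := by
  have h1 := (hr.primal_step k ω).norm_sub_sq_le hprob.convex hy
  set d := G (x k ω) (ξ k ω) + lam (k + 1) ω (j k ω) • g k ω with hd
  have h2 : ‖x k ω - gam k • d - y‖ ^ 2 =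
      ‖x k ω - y‖ ^ 2 - 2 * gam k * ⟪d, x k ω - y⟫ + gam k ^ 2 * ‖d‖ ^ 2 := by
    rw [sub_right_comm, norm_sub_sq_real, inner_smul_right, norm_smul, mul_pow,
      Real.norm_eq_abs, sq_abs, real_inner_comm]
    ring
  have h3 := hr.subgradient_mem k ω y (interior_subset (hprob.subset_interior _ hy))
  have h4 : ⟪d, x k ω - y⟫ = ⟪G (x k ω) (ξ k ω), x k ω - y⟫ +
      lam (k + 1) ω (j k ω) * ⟪g k ω, x k ω - y⟫ := by
    rw [hd, inner_add_left, inner_smul_left]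
    simp
  rw [← neg_sub (x k ω) y, inner_neg_right] at h3
  have h5 : lam (k + 1) ω (j k ω) * (f (j k ω) (x k ω) - f (j k ω) y) ≤
      lam (k + 1) ω (j k ω) * ⟪g k ω, x k ω - y⟫ :=
    mul_le_mul_of_nonneg_left (by linarith) (hr.lam_nonneg _ _ _)
  have h6 := mul_le_mul_of_nonneg_left h5 (hgam k).le
  rw [h2, h4] at h1
  linarith

theorem sum_mul_indexNoise (l : Fin J → ℝ) (k : ℕ) (ω : Ω) :
    ∑ i, l i * indexNoise f j x i k ω =
      l (j k ω) * f (j k ω) (x k ω) - (J : ℝ)⁻¹ * ∑ i, l i * f i (x k ω) := by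
  have : ∀ i, l i * indexNoise f j x i k ω =
      (if j k ω = i then l i * f i (x k ω) else 0) - (J : ℝ)⁻¹ * (l i * f i (x k ω)) := fun i => by
    unfold indexNoise
    split_ifs <;> ring
  simp only [this, Finset.sum_sub_distrib, Finset.mul_sum]
  simp

theorem abs_indexNoise_le {rho gam : ℕ → ℝ} {M : ℝ}
    (hr : IsRun X D f G rho gam ξ j x₀ x lam g) (hx₀ : x₀ ∈ X)
    (hMf : ∀ j, ∀ x ∈ X, |f j x| ≤ M) (i : Fin J) (k : ℕ) (ω : Ω) :
    |indexNoise f j x i k ω| ≤ M := by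
  have h1 : 0 ≤ (J : ℝ)⁻¹ := by positivity
  have h2 : (J : ℝ)⁻¹ ≤ 1 := Nat.cast_inv_le_one J
  have h3 : |(if j k ω = i then (1 : ℝ) else 0) - (J : ℝ)⁻¹| ≤ 1 := by
    split_ifs <;> rw [abs_le] <;> constructor <;> linarith
  rw [indexNoise, abs_mul]
  calc _ ≤ 1 * M := mul_le_mul h3 (hMf i _ (hr.mem hx₀ k ω)) (abs_nonneg _) zero_le_one
    _ = M := one_mul M

/-- An upper bound for the squared length of the primal direction at step `k`. -/
noncomputable def directionBound (M T ρ : ℝ) (F : Vec n → Vec n) (G : Vec n → S → Vec n)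
    (ξ : ℕ → Ω → S) (x : ℕ → Ω → Vec n) (lam : ℕ → Ω → Fin J → ℝ) (k : ℕ) (ω : Ω) : ℝ :=
  3 * M ^ 2 + 6 * M ^ 4 * ρ ^ 2 * T + 3 * ‖noise F G ξ x k ω‖ ^ 2 +
    6 * M ^ 2 * ∑ i, lam k ω i ^ 2

/-- The new multiplier is traded for the old one, at the cost of a constant, so that the energy
recursion closes at step k. -/
theorem IsRun.norm_direction_sq_le {gam : ℕ → ℝ}
    (hr : IsRun X D f G (stepsize ρ) gam ξ j x₀ x lam g) (hx₀ : x₀ ∈ X) {M T : ℝ}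
    (hMF : ∀ x ∈ X, ‖F x‖ ≤ M) (hMf : ∀ j, ∀ x ∈ X, |f j x| ≤ M)
    (hMg : ∀ j, ∀ x ∈ X, ∀ g ∈ subdifferential (D j) (f j) x, ‖g‖ ≤ M)
    (hT : ∀ k, stepsize 1 k ^ 2 ≤ T) (k : ℕ) (ω : Ω) :
    ‖G (x k ω) (ξ k ω) + lam (k + 1) ω (j k ω) • g k ω‖ ^ 2 ≤
      directionBound M T ρ F G ξ x lam k ω := by
  have hx := hr.mem hx₀ k ω
  set e := noise F G ξ x k ω with he
  set b := f (j k ω) (x k ω) with hb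
  set a := lam (k + 1) ω (j k ω) with ha
  set t := stepsize 1 k with ht
  have h0 : G (x k ω) (ξ k ω) = e + F (x k ω) := by rw [he, noise]; abel
  have h1 : ‖G (x k ω) (ξ k ω) + a • g k ω‖ ≤ ‖e‖ + M + |a| * M := by
    rw [h0]
    refine (norm_add_le _ _).trans (add_le_add ((norm_add_le _ _).trans ?_) ?_)
    · gcongr
      exact hMF _ hx
    · rw [norm_smul, Real.norm_eq_abs]
      gcongr
      exact hMg _ _ hx _ (hr.subgradient_mem k ω)
  have h2 : ‖G (x k ω) (ξ k ω) + a • g k ω‖ ^ 2 ≤ 3 * (‖e‖ ^ 2 + M ^ 2 + a ^ 2 * M ^ 2) := by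
    calc _ ≤ (‖e‖ + M + |a| * M) ^ 2 := by gcongr
      _ ≤ 3 * (‖e‖ ^ 2 + M ^ 2 + (|a| * M) ^ 2) := by
        nlinarith [sq_nonneg (‖e‖ - M), sq_nonneg (M - |a| * M), sq_nonneg (‖e‖ - |a| * M)]
      _ = _ := by rw [mul_pow, sq_abs]
  have h3 : a ^ 2 ≤ 2 * (ρ ^ 2 * T * M ^ 2) + 2 * ∑ i, lam k ω i ^ 2 := by
    have e1 : a = max (ρ * t * b + lam k ω (j k ω)) 0 := by
      rw [ha, hr.dual_step, if_pos rfl, stepsize_eq_mul]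
    have e2 : a ^ 2 ≤ (ρ * t * b + lam k ω (j k ω)) ^ 2 := by
      rw [e1]
      rcases le_total (ρ * t * b + lam k ω (j k ω)) 0 with h | h
      · rw [max_eq_right h]; rw [zero_pow two_ne_zero]; exact sq_nonneg _
      · rw [max_eq_left h]
    have e3 : lam k ω (j k ω) ^ 2 ≤ ∑ i, lam k ω i ^ 2 :=
      Finset.single_le_sum (f := fun i => lam k ω i ^ 2) (fun _ _ => sq_nonneg _)
        (Finset.mem_univ _)
    have e4 : (ρ * t * b) ^ 2 ≤ ρ ^ 2 * T * M ^ 2 := by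
      rw [mul_pow, mul_pow]
      have : b ^ 2 ≤ M ^ 2 := sq_le_sq.2 ((hMf _ _ hx).trans (le_abs_self M))
      have hT0 : 0 ≤ T := (sq_nonneg _).trans (hT k)
      gcongr
      exact hT k
    nlinarith [sq_nonneg (ρ * t * b - lam k ω (j k ω))]
  have h4 := mul_le_mul_of_nonneg_right h3 (sq_nonneg M)
  unfold directionBound
  nlinarith

/-- One step of the method decreases the energy up to noise and a second order term. -/
theorem IsRun.energy_succ_le (hprob : ProblemAssumptions X F D f) (hρ : 0 < ρ) (hγ : 0 < γ)
    (hr : IsRun X D f G (stepsize ρ) (stepsize γ) ξ j x₀ x lam g) (hx₀ : x₀ ∈ X) {M T : ℝ}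
    (hMF : ∀ x ∈ X, ‖F x‖ ≤ M) (hMf : ∀ j, ∀ x ∈ X, |f j x| ≤ M)
    (hMg : ∀ j, ∀ x ∈ X, ∀ g ∈ subdifferential (D j) (f j) x, ‖g‖ ≤ M)
    (hT : ∀ k, stepsize 1 k ^ 2 ≤ T) {y : Vec n} (hy : y ∈ feasible X f)
    {l : Fin J → ℝ} (hl : ∀ i, 0 ≤ l i) (k : ℕ) (ω : Ω) :
    energy ρ γ x lam y l (k + 1) ω ≤ energy ρ γ x lam y l k ω -
      2 * stepsize 1 k * (⟪F (x k ω), x k ω - y⟫ + (J : ℝ)⁻¹ * ∑ i, l i * f i (x k ω)) -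
      2 * stepsize 1 k * ⟪noise F G ξ x k ω, x k ω - y⟫ -
      2 * stepsize 1 k * ∑ i, l i * indexNoise f j x i k ω +
      γ * stepsize 1 k ^ 2 * directionBound M T ρ F G ξ x lam k ω := by
  have ht := stepsize_one_pos k
  have h1 := hr.norm_primal_sq_le hprob
    (fun k => by rw [stepsize_eq_mul]; exact mul_pos hγ (stepsize_one_pos k)) k ω hy.1
  have h2 := hr.sum_dual_sq_le k ω hl
  have h3 := hr.norm_direction_sq_le hx₀ hMF hMf hMg hT k ω
  rw [sum_mul_indexNoise]
  have h4 : ⟪G (x k ω) (ξ k ω), x k ω - y⟫ =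
      ⟪F (x k ω), x k ω - y⟫ + ⟪noise F G ξ x k ω, x k ω - y⟫ := by
    rw [← inner_add_left, noise, add_sub_cancel]
  rw [h4] at h1
  rw [stepsize_eq_mul γ] at h1
  rw [stepsize_eq_mul ρ] at h2
  have h5 : lam (k + 1) ω (j k ω) * f (j k ω) y ≤ 0 :=
    mul_nonpos_of_nonneg_of_nonpos (hr.lam_nonneg _ _ _) (hy.2 _)
  set t := stepsize 1 k
  unfold energy
  have h1' := div_le_div_of_nonneg_right h1 hγ.le
  have h2' := div_le_div_of_nonneg_right h2 hρ.le
  have e1 : ∀ a b c : ℝ, (a - 2 * (γ * t) * b + (γ * t) ^ 2 * c) / γ =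
      a / γ - 2 * t * b + γ * t ^ 2 * c := fun a b c => by field_simp
  have e2 : ∀ a b c : ℝ, (a + 2 * (ρ * t * b) * c) / ρ = a / ρ + 2 * t * b * c :=
    fun a b c => by field_simp
  rw [e1] at h1'
  rw [e2] at h2'
  have h3' := mul_le_mul_of_nonneg_left h3 (by positivity : 0 ≤ γ * t ^ 2)
  have h5' := mul_nonneg_of_nonpos_of_nonpos (by linarith : -(2 * t) ≤ 0) h5
  -- Adding the two estimates cancels the terms 2t λ_{k+1} f(x_k), with f the sampled constraint;
  -- the remaining λ_{k+1} f(y) ≤ 0 is dropped.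
  linarith

/-- A positive part is at least its argument, so the multiplier, started at 0, accumulates at least
the sampled values of its constraint. -/
theorem IsRun.sum_step_le_lam (hρ : 0 < ρ) {gam : ℕ → ℝ}
    (hr : IsRun X D f G (stepsize ρ) gam ξ j x₀ x lam g) (i : Fin J) (N : ℕ) (ω : Ω) :
    (J : ℝ)⁻¹ * ∑ k ∈ Finset.range N, stepsize 1 k * f i (x k ω) +
      ∑ k ∈ Finset.range N, stepsize 1 k * indexNoise f j x i k ω ≤ lam N ω i / ρ := by
  induction N with
  | zero => simp [hr.init_dual]
  | succ N ih =>
    rw [Finset.sum_range_succ, Finset.sum_range_succ, hr.dual_step, stepsize_eq_mul ρ]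
    have key : (J : ℝ)⁻¹ * (stepsize 1 N * f i (x N ω)) + stepsize 1 N * indexNoise f j x i N ω =
        if i = j N ω then stepsize 1 N * f i (x N ω) else 0 := by
      unfold indexNoise
      by_cases h : i = j N ω
      · rw [if_pos h, if_pos h.symm]; ring
      · rw [if_neg h, if_neg (Ne.symm h)]; ring
    have h2 : (lam N ω i) / ρ + (if i = j N ω then stepsize 1 N * f i (x N ω) else 0) ≤
        (if i = j N ω then max (ρ * stepsize 1 N * f i (x N ω) + lam N ω i) 0
          else lam N ω i) / ρ := by
      split_ifs with h
      · rw [le_div_iff₀ hρ, add_mul, div_mul_cancel₀ _ hρ.ne']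
        refine le_trans (le_of_eq ?_) (le_max_left _ _)
        ring
      · rw [add_zero]
    by_cases h : i = j N ω
    · subst h
      simp only [if_true] at key h2 ⊢
      linarith
    · simp only [if_neg h] at key h2 ⊢
      linarith

/-- This deterministic bound grows with N and serves only integrability; the uniform bound is in
mean square. -/
theorem IsRun.lam_le {gam : ℕ → ℝ} (hρ : 0 < ρ)
    (hr : IsRun X D f G (stepsize ρ) gam ξ j x₀ x lam g) (hx₀ : x₀ ∈ X) {M : ℝ} (hM : 0 ≤ M)
    (hMf : ∀ j, ∀ x ∈ X, |f j x| ≤ M) (i : Fin J) (N : ℕ) (ω : Ω) :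
    lam N ω i ≤ ∑ k ∈ Finset.range N, ρ * stepsize 1 k * M := by
  induction N with
  | zero => simp [hr.init_dual]
  | succ N ih =>
    have hp : 0 ≤ ρ * stepsize 1 N := (mul_pos hρ (stepsize_one_pos N)).le
    have h0 := hr.lam_nonneg N ω i
    rw [Finset.sum_range_succ, hr.dual_step, stepsize_eq_mul ρ]
    have h1 : ρ * stepsize 1 N * f i (x N ω) ≤ ρ * stepsize 1 N * M :=
      mul_le_mul_of_nonneg_left ((le_abs_self _).trans (hMf i _ (hr.mem hx₀ N ω))) hp
    have h2 : 0 ≤ ρ * stepsize 1 N * M := mul_nonneg hp hM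
    split_ifs
    · exact max_le (by linarith) (by linarith)
    · linarith

theorem IsRun.noise_eq_oracleError {rho gam : ℕ → ℝ}
    (hr : IsRun X D f G rho gam ξ j x₀ x lam g) (hx₀ : x₀ ∈ X) (k : ℕ)
    (ω : Ω) : noise F G ξ x k ω = oracleError X F G (x k ω, ξ k ω) :=
  (oracleError_of_mem (hr.mem hx₀ k ω) _).symm

end Pathwise

/-! ### Runs of the method: measurability and expectations -/

section Expectation

theorem measurable_indicator_of_continuousOn {n : ℕ} {X : Set (Vec n)} {E : Type*}
    [TopologicalSpace E] [MeasurableSpace E] [BorelSpace E] [Zero E] (hX : IsCompact X)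
    {φ : Vec n → E} (hφ : ContinuousOn φ X) : Measurable (X.indicator φ) := by
  classical
  rw [← Set.piecewise_eq_indicator]
  exact hφ.measurable_piecewise continuousOn_const hX.isClosed.measurableSet

theorem memLp_of_norm_le {Ω E : Type*} [MeasurableSpace Ω] {P : Measure Ω} [IsFiniteMeasure P]
    [NormedAddCommGroup E] {Z : Ω → E} (hZ : AEStronglyMeasurable Z P) {C : ℝ}
    (hC : ∀ ω, ‖Z ω‖ ≤ C) (p : ENNReal) : MemLp Z p P :=
  MemLp.of_bound hZ C (Filter.Eventually.of_forall hC)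

variable {n J : ℕ} {S Ω : Type*} [MeasurableSpace S] [MeasurableSpace Ω] {P : Measure Ω}
  {μ : Measure S} {X : Set (Vec n)} {F : Vec n → Vec n}
  {D : Fin J → Set (Vec n)} {f : Fin J → Vec n → ℝ} {G : Vec n → S → Vec n} {ν : ℝ}
  {rho gam : ℕ → ℝ}
  {ξ : ℕ → Ω → S} {j : ℕ → Ω → Fin J} {x₀ : Vec n} {x : ℕ → Ω → Vec n}
  {lam : ℕ → Ω → Fin J → ℝ} {g : ℕ → Ω → Vec n}

theorem SamplingAssumptions.past_le (hs : SamplingAssumptions P μ X F G ν ξ j) (k : ℕ) :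
    past ξ j k ≤ ‹MeasurableSpace Ω› :=
  RLSA.past_le hs.measurable_xi hs.measurable_index k

theorem SamplingAssumptions.indepFun_xi (hs : SamplingAssumptions P μ X F G ν ξ j) {α : Type*}
    [MeasurableSpace α] {U : Ω → α} {k : ℕ} (hU : Measurable[past ξ j k] U) :
    IndepFun U (ξ k) P :=
  (IndepFun_iff_Indep _ _ _).2 (indep_of_indep_of_le_left
    (indep_past_sample hs.measurable_xi hs.measurable_index hs.indep_xi hs.indep_index
      hs.indep_xi_index k (Sum.inl k) (Or.inl rfl)) hU.comap_le)

theorem SamplingAssumptions.indepFun_index (hs : SamplingAssumptions P μ X F G ν ξ j)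
    {α : Type*} [MeasurableSpace α] {U : Ω → α} {k : ℕ} (hU : Measurable[past ξ j k] U) :
    IndepFun U (j k) P :=
  (IndepFun_iff_Indep _ _ _).2 (indep_of_indep_of_le_left
    (indep_past_sample hs.measurable_xi hs.measurable_index hs.indep_xi hs.indep_index
      hs.indep_xi_index k (Sum.inr k) (Or.inr rfl)) hU.comap_le)

theorem measurable_comp_of_continuousOn {E : Type*} [TopologicalSpace E] [MeasurableSpace E]
    [BorelSpace E] [Zero E] (hX : IsCompact X) {φ : Vec n → E} (hφ : ContinuousOn φ X)
    {Ω : Type*} {m : MeasurableSpace Ω} {U : Ω → Vec n} (hU : Measurable U)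
    (hUX : ∀ ω, U ω ∈ X) : Measurable fun ω => φ (U ω) := by
  have : (fun ω => φ (U ω)) = fun ω => X.indicator φ (U ω) :=
    funext fun ω => (Set.indicator_of_mem (hUX ω) φ).symm
  rw [this]
  exact (measurable_indicator_of_continuousOn hX hφ).comp hU

theorem measurable_eval_index {Ω : Type*} {m : MeasurableSpace Ω} {l : Ω → Fin J → ℝ}
    {i : Ω → Fin J} (hl : ∀ a, Measurable fun ω => l ω a) (hi : Measurable i) :
    Measurable fun ω => l ω (i ω) := by
  have h1 : Measurable fun p : (Fin J → ℝ) × Fin J => p.1 p.2 :=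
    measurable_from_prod_countable_left fun a => measurable_pi_apply a
  exact h1.comp ((measurable_pi_iff.2 hl).prodMk hi)

/-- The iterates of step k depend only on samples drawn before step k, hence are independent of ξ k
and of j k. All mean-zero statements rest on this. -/
theorem IsRun.measurable_past (hprob : ProblemAssumptions X F D f)
    (hs : SamplingAssumptions P μ X F G ν ξ j)
    (hr : IsRun X D f G rho gam ξ j x₀ x lam g) (hx₀ : x₀ ∈ X) (k : ℕ) :
    Measurable[past ξ j k] (x k) ∧ ∀ i, Measurable[past ξ j k] fun ω => lam k ω i := by
  obtain ⟨π, hπ, hπeq⟩ := exists_continuous_projection hprob.convex hprob.compact hprob.nonempty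
  induction k with
  | zero =>
    have h1 : x 0 = fun _ => x₀ := funext hr.init_primal
    have h2 : ∀ i, (fun ω => lam 0 ω i) = fun _ => 0 := fun i => funext fun ω => hr.init_dual ω i
    exact ⟨h1 ▸ measurable_const, fun i => h2 i ▸ measurable_const⟩
  | succ k ih =>
    have hle := past_mono (ξ := ξ) (j := j) (Nat.le_succ k)
    have hx : Measurable[past ξ j (k + 1)] (x k) := ih.1.mono hle le_rfl
    have hlam : ∀ i, Measurable[past ξ j (k + 1)] fun ω => lam k ω i :=
      fun i => (ih.2 i).mono hle le_rfl
    have hj : Measurable[past ξ j (k + 1)] (j k) := measurable_index_past k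
    have hξ : Measurable[past ξ j (k + 1)] (ξ k) := measurable_xi_past k
    have hg : Measurable[past ξ j (k + 1)] (g k) := by
      rw [← history_eq_past]
      exact hr.subgradient_measurable k
    have hlam' : ∀ i, Measurable[past ξ j (k + 1)] fun ω => lam (k + 1) ω i := fun i => by
      have e : (fun ω => lam (k + 1) ω i) = fun ω =>
          if i = j k ω then max (rho k * f i (x k ω) + lam k ω i) 0 else lam k ω i :=
        funext fun ω => hr.dual_step k ω i
      rw [e]
      refine Measurable.ite ?_ ?_ (hlam i)
      · have : {ω | i = j k ω} = j k ⁻¹' {i} := by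
          ext ω
          simp [eq_comm]
        rw [this]
        exact hj (measurableSet_singleton i)
      · have hf := measurable_comp_of_continuousOn hprob.compact (hprob.continuousOn_f i) hx
          fun ω => hr.mem hx₀ k ω
        exact ((hf.const_mul _).add (hlam i)).max measurable_const
    refine ⟨?_, hlam'⟩
    have e : x (k + 1) = fun ω =>
        π (x k ω - gam k • (G (x k ω) (ξ k ω) + lam (k + 1) ω (j k ω) • g k ω)) :=
      funext fun ω => hπeq _ _ (hr.primal_step k ω)
    rw [e]
    have hG : Measurable[past ξ j (k + 1)] fun ω => G (x k ω) (ξ k ω) :=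
      hs.measurable_oracle.comp (hx.prodMk hξ)
    have hl := measurable_eval_index hlam' hj
    have hd : Measurable[past ξ j (k + 1)] fun ω =>
        gam k • (G (x k ω) (ξ k ω) + lam (k + 1) ω (j k ω) • g k ω) :=
      (hG.add (hl.smul hg)).const_smul (gam k)
    exact hπ.measurable.comp (hx.sub hd)

theorem measurable_noise (hprob : ProblemAssumptions X F D f)
    (hs : SamplingAssumptions P μ X F G ν ξ j)
    (hr : IsRun X D f G rho gam ξ j x₀ x lam g) (hx₀ : x₀ ∈ X) (k : ℕ) :
    Measurable[past ξ j (k + 1)] (noise F G ξ x k) := by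
  have hx : Measurable[past ξ j (k + 1)] (x k) :=
    (hr.measurable_past hprob hs hx₀ k).1.mono (past_mono (Nat.le_succ k)) le_rfl
  have hG : Measurable[past ξ j (k + 1)] fun ω => G (x k ω) (ξ k ω) :=
    hs.measurable_oracle.comp (hx.prodMk (measurable_xi_past k))
  exact hG.sub (measurable_comp_of_continuousOn hprob.compact hprob.continuousOn hx
    fun ω => hr.mem hx₀ k ω)

theorem measurable_indexNoise (hprob : ProblemAssumptions X F D f)
    (hs : SamplingAssumptions P μ X F G ν ξ j)
    (hr : IsRun X D f G rho gam ξ j x₀ x lam g) (hx₀ : x₀ ∈ X) (i : Fin J) (k : ℕ) :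
    Measurable[past ξ j (k + 1)] (indexNoise f j x i k) := by
  have hx : Measurable[past ξ j (k + 1)] (x k) :=
    (hr.measurable_past hprob hs hx₀ k).1.mono (past_mono (Nat.le_succ k)) le_rfl
  have hj : Measurable[past ξ j (k + 1)] (j k) := measurable_index_past k
  have h1 : Measurable fun a : Fin J => (if a = i then (1 : ℝ) else 0) - (J : ℝ)⁻¹ :=
    measurable_of_finite _
  exact (h1.comp hj).mul (measurable_comp_of_continuousOn hprob.compact (hprob.continuousOn_f i) hx
    fun ω => hr.mem hx₀ k ω)

theorem measurable_oracleError (hprob : ProblemAssumptions X F D f)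
    (hs : SamplingAssumptions P μ X F G ν ξ j) : Measurable (oracleError X F G) :=
  (hs.measurable_oracle.sub
    ((measurable_indicator_of_continuousOn hprob.compact hprob.continuousOn).comp
      measurable_fst)).indicator (hprob.compact.isClosed.measurableSet.prod MeasurableSet.univ)

variable [IsProbabilityMeasure P]

theorem lintegral_noise_sq_le (hprob : ProblemAssumptions X F D f)
    (hs : SamplingAssumptions P μ X F G ν ξ j)
    (hr : IsRun X D f G rho gam ξ j x₀ x lam g) (hx₀ : x₀ ∈ X) (k : ℕ) :
    ∫⁻ ω, ENNReal.ofReal (‖noise F G ξ x k ω‖ ^ 2) ∂P ≤ ENNReal.ofReal (ν ^ 2) := by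
  have hxk := (hr.measurable_past hprob hs hx₀ k).1
  simp only [hr.noise_eq_oracleError (F := F) hx₀]
  refine lintegral_comp_le_of_indepFun (h := fun p => ENNReal.ofReal (‖oracleError X F G p‖ ^ 2))
    (hxk.mono (hs.past_le k) le_rfl) (hs.measurable_xi k) (hs.indepFun_xi hxk)
    ((measurable_oracleError hprob hs).norm.pow_const 2).ennreal_ofReal fun y => ?_
  by_cases hy : y ∈ X
  · simp only [oracleError_of_mem hy]
    obtain ⟨h1, h2⟩ := hs.variance_le y hy k
    rw [← ofReal_integral_eq_lintegral_ofReal h1 (Filter.Eventually.of_forall fun _ => sq_nonneg _)]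
    exact ENNReal.ofReal_le_ofReal h2
  · simp [oracleError_of_notMem hy]

theorem memLp_noise (hprob : ProblemAssumptions X F D f)
    (hs : SamplingAssumptions P μ X F G ν ξ j)
    (hr : IsRun X D f G rho gam ξ j x₀ x lam g) (hx₀ : x₀ ∈ X) (k : ℕ) :
    MemLp (noise F G ξ x k) 2 P := by
  have hm : Measurable (noise F G ξ x k) :=
    (measurable_noise hprob hs hr hx₀ k).mono (hs.past_le _) le_rfl
  rw [memLp_two_iff_integrable_sq_norm hm.aestronglyMeasurable]
  refine ⟨(hm.norm.pow_const 2).aestronglyMeasurable, ?_⟩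
  rw [hasFiniteIntegral_iff_ofReal (Filter.Eventually.of_forall fun _ => sq_nonneg _)]
  exact (lintegral_noise_sq_le hprob hs hr hx₀ k).trans_lt ENNReal.ofReal_lt_top

theorem integral_noise_sq_le (hprob : ProblemAssumptions X F D f)
    (hs : SamplingAssumptions P μ X F G ν ξ j)
    (hr : IsRun X D f G rho gam ξ j x₀ x lam g) (hx₀ : x₀ ∈ X) (k : ℕ) :
    ∫ ω, ‖noise F G ξ x k ω‖ ^ 2 ∂P ≤ ν ^ 2 := by
  have h1 := (memLp_noise hprob hs hr hx₀ k).integrable_norm_pow two_ne_zero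
  have h2 := lintegral_noise_sq_le hprob hs hr hx₀ k
  rw [← ofReal_integral_eq_lintegral_ofReal h1
    (Filter.Eventually.of_forall fun _ => sq_nonneg _)] at h2
  exact (ENNReal.ofReal_le_ofReal_iff (sq_nonneg ν)).1 h2

theorem integral_inner_noise_eq_zero (hprob : ProblemAssumptions X F D f)
    (hs : SamplingAssumptions P μ X F G ν ξ j)
    (hr : IsRun X D f G rho gam ξ j x₀ x lam g) (hx₀ : x₀ ∈ X) {k : ℕ} {W : Ω → Vec n}
    (hW : Measurable[past ξ j k] W) (hW2 : MemLp W 2 P) :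
    ∫ ω, ⟪W ω, noise F G ξ x k ω⟫ ∂P = 0 := by
  have hxk := (hr.measurable_past hprob hs hx₀ k).1
  have hU : Measurable[past ξ j k] fun ω => (W ω, x k ω) := hW.prodMk hxk
  have hint := integrable_inner_of_memLp_two hW2 (memLp_noise hprob hs hr hx₀ k)
  simp only [hr.noise_eq_oracleError (F := F) hx₀] at hint ⊢
  -- Both the direction W and the query point are frozen while the fresh sample is integrated.
  refine integral_comp_eq_zero_of_indepFun (U := fun ω => (W ω, x k ω))
    (h := fun p => ⟪p.1.1, oracleError X F G (p.1.2, p.2)⟫)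
    (hU.mono (hs.past_le k) le_rfl) (hs.measurable_xi k) (hs.indepFun_xi hU) ?_ hint ?_
  · exact measurable_fst.fst.inner ((measurable_oracleError hprob hs).comp
      (measurable_fst.snd.prodMk measurable_snd))
  · rintro ⟨w, y⟩
    by_cases hy : y ∈ X
    · simp only [oracleError_of_mem hy]
      obtain ⟨h1, h2⟩ := hs.unbiased y hy k
      rw [integral_inner h1, h2, inner_zero_right]
    · simp [oracleError_of_notMem hy]

theorem integral_mul_indexNoise_eq_zero (hprob : ProblemAssumptions X F D f)
    (hs : SamplingAssumptions P μ X F G ν ξ j)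
    (hr : IsRun X D f G rho gam ξ j x₀ x lam g) (hx₀ : x₀ ∈ X) {k : ℕ} (i : Fin J) {W : Ω → ℝ}
    (hW : Measurable[past ξ j k] W) (hint : Integrable (fun ω => W ω * indexNoise f j x i k ω) P) :
    ∫ ω, W ω * indexNoise f j x i k ω ∂P = 0 := by
  have hxk := (hr.measurable_past hprob hs hx₀ k).1
  have hU : Measurable[past ξ j k] fun ω => W ω * f i (x k ω) :=
    hW.mul (measurable_comp_of_continuousOn hprob.compact (hprob.continuousOn_f i) hxk
      fun ω => hr.mem hx₀ k ω)
  have e : ∀ ω, W ω * indexNoise f j x i k ω =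
      (W ω * f i (x k ω)) * ((if j k ω = i then (1 : ℝ) else 0) - (J : ℝ)⁻¹) := fun ω => by
    rw [indexNoise]; ring
  simp only [e] at hint ⊢
  refine integral_comp_eq_zero_of_indepFun (U := fun ω => W ω * f i (x k ω))
    (h := fun p : ℝ × Fin J => p.1 * ((if p.2 = i then (1 : ℝ) else 0) - (J : ℝ)⁻¹))
    (hU.mono (hs.past_le k) le_rfl) (hs.measurable_index k) (hs.indepFun_index hU) ?_ hint ?_
  · have h1 : Measurable fun a : Fin J => (if a = i then (1 : ℝ) else 0) - (J : ℝ)⁻¹ :=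
      measurable_of_finite _
    exact measurable_fst.mul (h1.comp measurable_snd)
  · intro u
    have hset : MeasurableSet {ω | j k ω = i} := hs.measurable_index k (measurableSet_singleton i)
    have e2 : (fun ω => if j k ω = i then (1 : ℝ) else 0) = {ω | j k ω = i}.indicator 1 := by
      ext ω
      simp [Set.indicator_apply]
    have i1 : Integrable (fun ω => if j k ω = i then (1 : ℝ) else 0) P := by
      rw [e2]
      exact (integrable_const 1).indicator hset
    change ∫ ω, u * ((if j k ω = i then (1 : ℝ) else 0) - (J : ℝ)⁻¹) ∂P = 0
    rw [integral_const_mul, integral_sub i1 (integrable_const _), e2, integral_indicator_one hset,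
      hs.uniform_index]
    simp

end Expectation

/-! ### Runs of the method: bounds in expectation -/

/-- Induction on the bound with partial sums of t², using 1 + s ≤ exp s; the sums are replaced by T
only at the end. -/
theorem discrete_gronwall_sq {a t : ℕ → ℝ} {α β T : ℝ} (hα : 0 ≤ α) (hβ : 0 ≤ β) (h0 : 0 ≤ a 0)
    (hT : ∀ N, ∑ k ∈ Finset.range N, t k ^ 2 ≤ T)
    (h : ∀ k, a (k + 1) ≤ a k + t k ^ 2 * (α + β * a k)) (k : ℕ) :
    a k ≤ (a 0 + α * T) * Real.exp (β * T) := by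
  have key : ∀ k, a k ≤ (a 0 + α * ∑ i ∈ Finset.range k, t i ^ 2) *
      Real.exp (β * ∑ i ∈ Finset.range k, t i ^ 2) := by
    intro k
    induction k with
    | zero => simp
    | succ k ih =>
      set s := ∑ i ∈ Finset.range k, t i ^ 2 with hs
      have hs0 : 0 ≤ s := Finset.sum_nonneg fun _ _ => sq_nonneg _
      have ht := sq_nonneg (t k)
      rw [Finset.sum_range_succ, ← hs]
      have h1 : 1 + β * t k ^ 2 ≤ Real.exp (β * t k ^ 2) := by
        linarith [Real.add_one_le_exp (β * t k ^ 2)]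
      have h2 : Real.exp (β * (s + t k ^ 2)) = Real.exp (β * s) * Real.exp (β * t k ^ 2) := by
        rw [mul_add, Real.exp_add]
      have h3 : 1 ≤ Real.exp (β * (s + t k ^ 2)) := Real.one_le_exp (by positivity)
      have hb : 0 ≤ β * t k ^ 2 := by positivity
      calc a (k + 1) ≤ a k * (1 + β * t k ^ 2) + α * t k ^ 2 := by linarith [h k]
        _ ≤ (a 0 + α * s) * Real.exp (β * s) * (1 + β * t k ^ 2) + α * t k ^ 2 := by gcongr
        _ ≤ (a 0 + α * s) * Real.exp (β * s) * Real.exp (β * t k ^ 2) +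
            α * t k ^ 2 * Real.exp (β * (s + t k ^ 2)) := by
          have : α * t k ^ 2 * 1 ≤ α * t k ^ 2 * Real.exp (β * (s + t k ^ 2)) := by gcongr
          have : (a 0 + α * s) * Real.exp (β * s) * (1 + β * t k ^ 2) ≤
            (a 0 + α * s) * Real.exp (β * s) * Real.exp (β * t k ^ 2) := by gcongr
          linarith
        _ = (a 0 + α * (s + t k ^ 2)) * Real.exp (β * (s + t k ^ 2)) := by rw [h2]; ring
  have hT0 : 0 ≤ ∑ i ∈ Finset.range k, t i ^ 2 := Finset.sum_nonneg fun _ _ => sq_nonneg _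
  refine (key k).trans ?_
  have hk := hT k
  have hT1 : 0 ≤ T := hT0.trans hk
  gcongr

section Expectation

variable {n J : ℕ} {S Ω : Type*} [MeasurableSpace S] [MeasurableSpace Ω] {P : Measure Ω}
  [IsProbabilityMeasure P] {μ : Measure S} {X : Set (Vec n)} {F : Vec n → Vec n}
  {D : Fin J → Set (Vec n)} {f : Fin J → Vec n → ℝ} {G : Vec n → S → Vec n} {ν ρ γ M T : ℝ}
  {ξ : ℕ → Ω → S} {j : ℕ → Ω → Fin J} {x₀ : Vec n} {x : ℕ → Ω → Vec n}
  {lam : ℕ → Ω → Fin J → ℝ} {g : ℕ → Ω → Vec n}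

theorem integrable_comp_of_continuousOn (hX : IsCompact X) {φ : Vec n → ℝ}
    (hφ : ContinuousOn φ X) {U : Ω → Vec n} (hU : Measurable U) (hUX : ∀ ω, U ω ∈ X) :
    Integrable (fun ω => φ (U ω)) P := by
  obtain ⟨C, hC⟩ := hX.exists_bound_of_continuousOn hφ
  exact memLp_one_iff_integrable.1 (memLp_of_norm_le
    (measurable_comp_of_continuousOn hX hφ hU hUX).aestronglyMeasurable
    (fun ω => hC _ (hUX ω)) 1)

theorem memLp_primal (hprob : ProblemAssumptions X F D f)
    (hs : SamplingAssumptions P μ X F G ν ξ j) {rho gam : ℕ → ℝ}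
    (hr : IsRun X D f G rho gam ξ j x₀ x lam g) (hx₀ : x₀ ∈ X) (k : ℕ) : MemLp (x k) 2 P := by
  obtain ⟨M, -, hMX, -⟩ := hprob.exists_bound
  exact memLp_of_norm_le ((hr.measurable_past hprob hs hx₀ k).1.mono
    (hs.past_le k) le_rfl).aestronglyMeasurable (fun ω => hMX _ (hr.mem hx₀ k ω)) 2

theorem memLp_dual (hprob : ProblemAssumptions X F D f) (hρ : 0 < ρ)
    (hs : SamplingAssumptions P μ X F G ν ξ j) {gam : ℕ → ℝ}
    (hr : IsRun X D f G (stepsize ρ) gam ξ j x₀ x lam g) (hx₀ : x₀ ∈ X) (k : ℕ) (i : Fin J) :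
    MemLp (fun ω => lam k ω i) 2 P := by
  obtain ⟨M, hM, -, -, hMf, -⟩ := hprob.exists_bound
  refine memLp_of_norm_le (((hr.measurable_past hprob hs hx₀ k).2 i).mono
    (hs.past_le k) le_rfl).aestronglyMeasurable
    (C := ∑ k ∈ Finset.range k, ρ * stepsize 1 k * M) (fun ω => ?_) 2
  rw [Real.norm_of_nonneg (hr.lam_nonneg k ω i)]
  exact hr.lam_le hρ hx₀ hM hMf i k ω

theorem memLp_indexNoise (hprob : ProblemAssumptions X F D f)
    (hs : SamplingAssumptions P μ X F G ν ξ j) {rho gam : ℕ → ℝ}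
    (hr : IsRun X D f G rho gam ξ j x₀ x lam g) (hx₀ : x₀ ∈ X) (i : Fin J) (k : ℕ) :
    MemLp (indexNoise f j x i k) 2 P := by
  obtain ⟨M, hM, -, -, hMf, -⟩ := hprob.exists_bound
  exact memLp_of_norm_le ((measurable_indexNoise hprob hs hr hx₀ i k).mono
    (hs.past_le _) le_rfl).aestronglyMeasurable (fun ω => abs_indexNoise_le hr hx₀ hMf i k ω) 2

theorem integrable_sum_dual_sq (hprob : ProblemAssumptions X F D f) (hρ : 0 < ρ)
    (hs : SamplingAssumptions P μ X F G ν ξ j) {gam : ℕ → ℝ}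
    (hr : IsRun X D f G (stepsize ρ) gam ξ j x₀ x lam g) (hx₀ : x₀ ∈ X) (l : Fin J → ℝ) (k : ℕ) :
    Integrable (fun ω => ∑ i, (lam k ω i - l i) ^ 2) P :=
  integrable_finsetSum _ fun i _ =>
    ((memLp_dual hprob hρ hs hr hx₀ k i).sub (memLp_const (l i))).integrable_sq

theorem integrable_energy (hprob : ProblemAssumptions X F D f) (hρ : 0 < ρ)
    (hs : SamplingAssumptions P μ X F G ν ξ j) {gam : ℕ → ℝ}
    (hr : IsRun X D f G (stepsize ρ) gam ξ j x₀ x lam g) (hx₀ : x₀ ∈ X) (y : Vec n)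
    (l : Fin J → ℝ) (k : ℕ) : Integrable (energy ρ γ x lam y l k) P :=
  ((((memLp_primal hprob hs hr hx₀ k).sub (memLp_const y)).integrable_norm_pow
    two_ne_zero).div_const γ).add ((integrable_sum_dual_sq hprob hρ hs hr hx₀ l k).div_const ρ)

theorem integrable_directionBound (hprob : ProblemAssumptions X F D f) (hρ : 0 < ρ)
    (hs : SamplingAssumptions P μ X F G ν ξ j) {gam : ℕ → ℝ}
    (hr : IsRun X D f G (stepsize ρ) gam ξ j x₀ x lam g) (hx₀ : x₀ ∈ X) (k : ℕ) :
    Integrable (directionBound M T ρ F G ξ x lam k) P := by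
  have h1 := integrable_sum_dual_sq hprob hρ hs hr hx₀ 0 k
  simp only [Pi.zero_apply, sub_zero] at h1
  exact ((integrable_const _).add (((memLp_noise hprob hs hr hx₀ k).integrable_norm_pow
    two_ne_zero).const_mul 3)).add (h1.const_mul _)

theorem integral_directionBound_le (hprob : ProblemAssumptions X F D f) (hρ : 0 < ρ)
    (hs : SamplingAssumptions P μ X F G ν ξ j) {gam : ℕ → ℝ}
    (hr : IsRun X D f G (stepsize ρ) gam ξ j x₀ x lam g) (hx₀ : x₀ ∈ X) (k : ℕ) :
    ∫ ω, directionBound M T ρ F G ξ x lam k ω ∂P ≤ 3 * M ^ 2 + 6 * M ^ 4 * ρ ^ 2 * T + 3 * ν ^ 2 +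
      6 * M ^ 2 * ∫ ω, ∑ i, lam k ω i ^ 2 ∂P := by
  have h1 := integrable_sum_dual_sq hprob hρ hs hr hx₀ 0 k
  simp only [Pi.zero_apply, sub_zero] at h1
  have h2 := (memLp_noise hprob hs hr hx₀ k).integrable_norm_pow two_ne_zero
  have h3 : Integrable (fun ω => 3 * M ^ 2 + 6 * M ^ 4 * ρ ^ 2 * T +
      3 * ‖noise F G ξ x k ω‖ ^ 2) P := (integrable_const _).add (h2.const_mul 3)
  unfold directionBound
  rw [integral_add h3 (h1.const_mul _), integral_add (integrable_const _) (h2.const_mul 3),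
    integral_const_mul, integral_const_mul, integral_const, probReal_univ, one_smul]
  linarith [integral_noise_sq_le hprob hs hr hx₀ k]

theorem integral_inner_noise_sub_eq_zero (hprob : ProblemAssumptions X F D f)
    (hs : SamplingAssumptions P μ X F G ν ξ j) {rho gam : ℕ → ℝ}
    (hr : IsRun X D f G rho gam ξ j x₀ x lam g) (hx₀ : x₀ ∈ X) (y : Vec n) (k : ℕ) :
    Integrable (fun ω => ⟪noise F G ξ x k ω, x k ω - y⟫) P ∧
      ∫ ω, ⟪noise F G ξ x k ω, x k ω - y⟫ ∂P = 0 := by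
  have h1 : MemLp (fun ω => x k ω - y) 2 P :=
    (memLp_primal hprob hs hr hx₀ k).sub (memLp_const y)
  have h2 : Measurable[past ξ j k] fun ω => x k ω - y :=
    (hr.measurable_past hprob hs hx₀ k).1.sub measurable_const
  refine ⟨integrable_inner_of_memLp_two (memLp_noise hprob hs hr hx₀ k) h1, ?_⟩
  rw [← integral_inner_noise_eq_zero hprob hs hr hx₀ h2 h1]
  exact integral_congr_ae (Filter.Eventually.of_forall fun ω => real_inner_comm _ _)

/-- The expected energy relative to a saddle point satisfies a Gronwall type recursion. -/
theorem integral_energy_succ_le (hprob : ProblemAssumptions X F D f) (hJ : 0 < J) (hρ : 0 < ρ)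
    (hγ : 0 < γ) (hs : SamplingAssumptions P μ X F G ν ξ j)
    (hr : IsRun X D f G (stepsize ρ) (stepsize γ) ξ j x₀ x lam g) (hx₀ : x₀ ∈ X)
    (hMF : ∀ x ∈ X, ‖F x‖ ≤ M) (hMf : ∀ j, ∀ x ∈ X, |f j x| ≤ M)
    (hMg : ∀ j, ∀ x ∈ X, ∀ g ∈ subdifferential (D j) (f j) x, ‖g‖ ≤ M)
    (hT : ∀ k, stepsize 1 k ^ 2 ≤ T) {y : Vec n} (hy : y ∈ feasible X f)
    {l : Fin J → ℝ} (hl : ∀ i, 0 ≤ l i)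
    (hyl : ∀ z ∈ X, 0 ≤ ⟪F z, z - y⟫ + ∑ i, l i * f i z) (k : ℕ) :
    ∫ ω, energy ρ γ x lam y (fun i => J * l i) (k + 1) ω ∂P ≤
      ∫ ω, energy ρ γ x lam y (fun i => J * l i) k ω ∂P +
      γ * stepsize 1 k ^ 2 * ∫ ω, directionBound M T ρ F G ξ x lam k ω ∂P := by
  have hJ' : (J : ℝ) ≠ 0 := by exact_mod_cast hJ.ne'
  set t := stepsize 1 k with ht
  have i1 := integrable_energy (γ := γ) hprob hρ hs hr hx₀ y (fun i => (J : ℝ) * l i) k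
  have i1' := integrable_energy (γ := γ) hprob hρ hs hr hx₀ y (fun i => (J : ℝ) * l i) (k + 1)
  obtain ⟨i2, z2⟩ := integral_inner_noise_sub_eq_zero hprob hs hr hx₀ y k
  have i3 : ∀ i, Integrable (fun ω => (J * l i) * indexNoise f j x i k ω) P := fun i =>
    ((memLp_indexNoise hprob hs hr hx₀ i k).integrable one_le_two).const_mul _
  have i3' : Integrable (fun ω => ∑ i, (J * l i) * indexNoise f j x i k ω) P :=
    integrable_finsetSum _ fun i _ => i3 i
  have z3 : ∫ ω, ∑ i, (J * l i) * indexNoise f j x i k ω ∂P = 0 := by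
    rw [integral_finsetSum _ fun i _ => i3 i]
    exact Finset.sum_eq_zero fun i _ =>
      integral_mul_indexNoise_eq_zero hprob hs hr hx₀ i measurable_const (i3 i)
  have i4 := integrable_directionBound (M := M) (T := T) hprob hρ hs hr hx₀ k
  have i12 : Integrable (fun ω => energy ρ γ x lam y (fun i => J * l i) k ω +
      -(2 * t) * ⟪noise F G ξ x k ω, x k ω - y⟫) P := i1.add (i2.const_mul _)
  have i123 : Integrable (fun ω => energy ρ γ x lam y (fun i => J * l i) k ω +
      -(2 * t) * ⟪noise F G ξ x k ω, x k ω - y⟫ +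
      -(2 * t) * ∑ i, (J * l i) * indexNoise f j x i k ω) P := i12.add (i3'.const_mul _)
  calc _ ≤ ∫ ω, (energy ρ γ x lam y (fun i => J * l i) k ω +
      -(2 * t) * ⟪noise F G ξ x k ω, x k ω - y⟫ +
      -(2 * t) * ∑ i, (J * l i) * indexNoise f j x i k ω +
      γ * t ^ 2 * directionBound M T ρ F G ξ x lam k ω) ∂P := by
        refine integral_mono i1' (i123.add (i4.const_mul _)) fun ω => ?_
        -- Uniform sampling weights each constraint by J⁻¹. Centring the dual energy at J l
        -- compensates for this, and the saddle inequality for l then removes the gap term.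
        have h1 := hr.energy_succ_le hprob hρ hγ hx₀ hMF hMf hMg hT hy
          (l := fun i => J * l i) (fun i => mul_nonneg (Nat.cast_nonneg J) (hl i)) k ω
        have h2 : (J : ℝ)⁻¹ * ∑ i, (J * l i) * f i (x k ω) = ∑ i, l i * f i (x k ω) := by
          rw [Finset.mul_sum]
          refine Finset.sum_congr rfl fun i _ => ?_
          field_simp
        rw [h2] at h1
        have h3 := mul_nonneg (by have := stepsize_one_pos k; positivity : 0 ≤ 2 * t)
          (hyl _ (hr.mem hx₀ k ω))
        simp only [← ht] at h1 ⊢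
        linarith
    _ = _ := by
        rw [integral_add i123 (i4.const_mul _), integral_add i12 (i3'.const_mul _),
          integral_add i1 (i2.const_mul _), integral_const_mul, integral_const_mul,
          integral_const_mul, z2, z3]
        ring

/-- A bound for the expected squared length of the dual iterates, in terms of a bound `M` of the
problem data, a bound `T` of the sum of the squared weights, and a multiplier `l`. -/
noncomputable def dualBound (M T ρ γ ν : ℝ) (l : Fin J → ℝ) : ℝ :=
  2 * ρ * (((2 * M) ^ 2 / γ + (∑ i, l i ^ 2) / ρ +
    γ * (3 * M ^ 2 + 6 * M ^ 4 * ρ ^ 2 * T + 3 * ν ^ 2 + 12 * M ^ 2 * ∑ i, l i ^ 2) * T) *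
      Real.exp (γ * (12 * M ^ 2 * ρ) * T)) + 2 * ∑ i, l i ^ 2

/-- The squared dual norm is at most 2ρ times the energy plus 2‖m‖², with m = J l. The second order
term is thus affine in the expected energy with coefficient t_k², and Gronwall applies. -/
theorem integral_dual_sq_le (hprob : ProblemAssumptions X F D f) (hJ : 0 < J) (hρ : 0 < ρ)
    (hγ : 0 < γ) (hs : SamplingAssumptions P μ X F G ν ξ j)
    (hr : IsRun X D f G (stepsize ρ) (stepsize γ) ξ j x₀ x lam g) (hx₀ : x₀ ∈ X)
    (hMX : ∀ x ∈ X, ‖x‖ ≤ M)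
    (hMF : ∀ x ∈ X, ‖F x‖ ≤ M) (hMf : ∀ j, ∀ x ∈ X, |f j x| ≤ M)
    (hMg : ∀ j, ∀ x ∈ X, ∀ g ∈ subdifferential (D j) (f j) x, ‖g‖ ≤ M)
    (hT : ∀ N, ∑ k ∈ Finset.range N, stepsize 1 k ^ 2 ≤ T) {y : Vec n} (hy : y ∈ feasible X f)
    {l : Fin J → ℝ} (hl : ∀ i, 0 ≤ l i)
    (hyl : ∀ z ∈ X, 0 ≤ ⟪F z, z - y⟫ + ∑ i, l i * f i z) (k : ℕ) :
    ∫ ω, ∑ i, lam k ω i ^ 2 ∂P ≤ dualBound M T ρ γ ν fun i => J * l i := by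
  have hT0 : 0 ≤ T := by simpa using hT 0
  have hT1 : ∀ k, stepsize 1 k ^ 2 ≤ T := fun k =>
    (Finset.single_le_sum (f := fun i => stepsize 1 i ^ 2) (fun _ _ => sq_nonneg _)
      (Finset.self_mem_range_succ k)).trans (hT (k + 1))
  set m : Fin J → ℝ := fun i => J * l i with hm
  set a : ℕ → ℝ := fun k => ∫ ω, energy ρ γ x lam y m k ω ∂P with ha
  have hlam : ∀ k, ∫ ω, ∑ i, lam k ω i ^ 2 ∂P ≤ 2 * ρ * a k + 2 * ∑ i, m i ^ 2 := fun k => by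
    have i1 := integrable_energy (γ := γ) hprob hρ hs hr hx₀ y m k
    have i2 := integrable_sum_dual_sq hprob hρ hs hr hx₀ 0 k
    simp only [Pi.zero_apply, sub_zero] at i2
    calc _ ≤ ∫ ω, (2 * ρ * energy ρ γ x lam y m k ω + 2 * ∑ i, m i ^ 2) ∂P := by
          refine integral_mono i2 ((i1.const_mul _).add (integrable_const _)) fun ω => ?_
          have h1 : ∑ i, (lam k ω i - m i) ^ 2 ≤ ρ * energy ρ γ x lam y m k ω := by
            have : 0 ≤ ρ * (‖x k ω - y‖ ^ 2 / γ) := by positivity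
            rw [energy, mul_add, mul_div_cancel₀ _ hρ.ne']
            linarith
          have h2 : ∑ i, lam k ω i ^ 2 ≤
              2 * ∑ i, (lam k ω i - m i) ^ 2 + 2 * ∑ i, m i ^ 2 := by
            rw [Finset.mul_sum, Finset.mul_sum, ← Finset.sum_add_distrib]
            exact Finset.sum_le_sum fun i _ => by nlinarith [sq_nonneg (lam k ω i - 2 * m i)]
          change ∑ i, lam k ω i ^ 2 ≤ 2 * ρ * energy ρ γ x lam y m k ω + 2 * ∑ i, m i ^ 2
          linarith
      _ = _ := by
          rw [integral_add (i1.const_mul _) (integrable_const _), integral_const_mul,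
            integral_const, probReal_univ, one_smul]
  have ha0 : a 0 ≤ (2 * M) ^ 2 / γ + (∑ i, m i ^ 2) / ρ := by
    have h1 : ∀ ω, energy ρ γ x lam y m 0 ω ≤ (2 * M) ^ 2 / γ + (∑ i, m i ^ 2) / ρ := fun ω => by
      have : ‖x 0 ω - y‖ ≤ 2 * M :=
        (norm_sub_le _ _).trans (by linarith [hMX _ (hr.mem hx₀ 0 ω), hMX y hy.1])
      simp only [energy, hr.init_dual, zero_sub, neg_sq]
      gcongr
    have h2 := integral_mono (integrable_energy (γ := γ) hprob hρ hs hr hx₀ y m 0)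
      (integrable_const ((2 * M) ^ 2 / γ + (∑ i, m i ^ 2) / ρ)) h1
    rwa [integral_const, probReal_univ, one_smul] at h2
  have ha0' : 0 ≤ a 0 := integral_nonneg fun ω => by
    change 0 ≤ ‖x 0 ω - y‖ ^ 2 / γ + (∑ i, (lam 0 ω i - m i) ^ 2) / ρ
    positivity
  -- The factor 6M² of `directionBound` times the two factors 2 in `hlam` gives the 12 in both α and
  -- β.
  have hg := discrete_gronwall_sq (a := a) (t := stepsize 1) (T := T)
    (α := γ * (3 * M ^ 2 + 6 * M ^ 4 * ρ ^ 2 * T + 3 * ν ^ 2 + 12 * M ^ 2 * ∑ i, m i ^ 2))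
    (β := γ * (12 * M ^ 2 * ρ)) (by positivity) (by positivity) ha0' hT (fun k => by
      have h1 := integral_energy_succ_le hprob hJ hρ hγ hs hr hx₀ hMF hMf hMg hT1 hy hl hyl k
      have h2 := integral_directionBound_le (M := M) (T := T) hprob hρ hs hr hx₀ k
      have h3 := mul_le_mul_of_nonneg_left (hlam k) (by positivity : 0 ≤ 6 * M ^ 2)
      have h4 := mul_le_mul_of_nonneg_left (h2.trans (add_le_add_right h3 _))
        (by positivity : 0 ≤ γ * stepsize 1 k ^ 2)
      refine h1.trans ?_
      change a k + _ ≤ _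
      linarith) k
  refine (hlam k).trans ?_
  unfold dualBound
  have h5 : a k ≤ ((2 * M) ^ 2 / γ + (∑ i, m i ^ 2) / ρ +
      γ * (3 * M ^ 2 + 6 * M ^ 4 * ρ ^ 2 * T + 3 * ν ^ 2 + 12 * M ^ 2 * ∑ i, m i ^ 2) * T) *
      Real.exp (γ * (12 * M ^ 2 * ρ) * T) := hg.trans (by gcongr)
  gcongr

/-- The weighted sum of the oracle errors is bounded in mean square. -/
theorem integral_norm_sum_noise_le (hprob : ProblemAssumptions X F D f)
    (hs : SamplingAssumptions P μ X F G ν ξ j) {rho gam : ℕ → ℝ}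
    (hr : IsRun X D f G rho gam ξ j x₀ x lam g) (hx₀ : x₀ ∈ X)
    (hT : ∀ N, ∑ k ∈ Finset.range N, stepsize 1 k ^ 2 ≤ T) (N : ℕ) :
    Integrable (fun ω => ‖∑ k ∈ Finset.range N, stepsize 1 k • noise F G ξ x k ω‖) P ∧
      ∫ ω, ‖∑ k ∈ Finset.range N, stepsize 1 k • noise F G ξ x k ω‖ ∂P ≤ 1 + ν ^ 2 * T := by
  have hZ := memLp_noise hprob hs hr hx₀
  have hS : ∀ N, MemLp (fun ω => ∑ k ∈ Finset.range N, stepsize 1 k • noise F G ξ x k ω) 2 P :=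
    fun N => memLp_finsetSum _ fun k _ => (hZ k).const_smul (stepsize 1 k)
  refine ⟨((hS N).integrable one_le_two).norm, integral_norm_le_of_sq_le (hS N) ?_⟩
  refine (integral_norm_sum_sq_le hZ (integral_noise_sq_le hprob hs hr hx₀) (fun k => ?_) N).trans
    (mul_le_mul_of_nonneg_left (hT N) (sq_nonneg ν))
  exact integral_inner_noise_eq_zero hprob hs hr hx₀ (Finset.measurable_sum _ fun i hi =>
    ((measurable_noise hprob hs hr hx₀ i).mono
      (past_mono (Finset.mem_range.1 hi)) le_rfl).const_smul (stepsize 1 i)) (hS k)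

/-- The weighted sum of the index errors is bounded in mean square. -/
theorem integral_abs_sum_indexNoise_le (hprob : ProblemAssumptions X F D f)
    (hs : SamplingAssumptions P μ X F G ν ξ j) {rho gam : ℕ → ℝ}
    (hr : IsRun X D f G rho gam ξ j x₀ x lam g) (hx₀ : x₀ ∈ X)
    (hMf : ∀ j, ∀ x ∈ X, |f j x| ≤ M)
    (hT : ∀ N, ∑ k ∈ Finset.range N, stepsize 1 k ^ 2 ≤ T) (i : Fin J) (N : ℕ) :
    Integrable (fun ω => |∑ k ∈ Finset.range N, stepsize 1 k * indexNoise f j x i k ω|) P ∧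
      ∫ ω, |∑ k ∈ Finset.range N, stepsize 1 k * indexNoise f j x i k ω| ∂P ≤
        1 + M ^ 2 * T := by
  have hZ := memLp_indexNoise hprob hs hr hx₀ i
  have hS : ∀ N, MemLp (fun ω => ∑ k ∈ Finset.range N, stepsize 1 k • indexNoise f j x i k ω) 2 P :=
    fun N => memLp_finsetSum _ fun k _ => (hZ k).const_smul (stepsize 1 k)
  have hsq : ∀ k, ∫ ω, ‖indexNoise f j x i k ω‖ ^ 2 ∂P ≤ M ^ 2 := fun k => by
    have h1 := integral_mono ((hZ k).integrable_norm_pow two_ne_zero)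
      (integrable_const (M ^ 2)) fun ω => by
        change ‖indexNoise f j x i k ω‖ ^ 2 ≤ M ^ 2
        have := abs_indexNoise_le hr hx₀ hMf i k ω
        rw [Real.norm_eq_abs]
        gcongr
    rwa [integral_const, probReal_univ, one_smul] at h1
  refine ⟨((hS N).integrable one_le_two).norm, integral_norm_le_of_sq_le (hS N) ?_⟩
  refine (integral_norm_sum_sq_le hZ hsq (fun k => ?_) N).trans
    (mul_le_mul_of_nonneg_left (hT N) (sq_nonneg M))
  have hW : Measurable[past ξ j k] fun ω =>
      ∑ a ∈ Finset.range k, stepsize 1 a • indexNoise f j x i a ω :=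
    Finset.measurable_sum _ fun a ha => ((measurable_indexNoise hprob hs hr hx₀ i a).mono
      (past_mono (Finset.mem_range.1 ha)) le_rfl).const_smul (stepsize 1 a)
  have e : ∀ a b : ℝ, ⟪a, b⟫ = a * b := fun a b => by simp [mul_comm]
  simp only [e]
  exact integral_mul_indexNoise_eq_zero hprob hs hr hx₀ i hW
    (MemLp.integrable_mul (hS k) (hZ k))

end Expectation

/-! ### The convergence rate -/

section Rate

variable {n J : ℕ} {S Ω : Type*} [MeasurableSpace S] {X : Set (Vec n)} {F : Vec n → Vec n}
  {D : Fin J → Set (Vec n)} {f : Fin J → Vec n → ℝ} {G : Vec n → S → Vec n} {ν ρ γ M T L : ℝ}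
  {ξ : ℕ → Ω → S} {j : ℕ → Ω → Fin J} {x₀ : Vec n} {x : ℕ → Ω → Vec n}
  {lam : ℕ → Ω → Fin J → ℝ} {g : ℕ → Ω → Vec n}

theorem weightedAverage_mem (hX : Convex ℝ X) {z : ℕ → Vec n} (hz : ∀ k, z k ∈ X) (K : ℕ) :
    weightedAverage (stepsize 1) z K ∈ X := by
  rw [weightedAverage, Finset.smul_sum]
  simp only [smul_smul]
  refine hX.sum_mem (fun k _ => ?_) ?_ fun k _ => hz k
  · exact mul_nonneg (inv_nonneg.2 (sum_stepsize_pos K).le) (stepsize_one_pos k).le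
  · rw [← Finset.mul_sum, inv_mul_cancel₀ (sum_stepsize_pos K).ne']

theorem sum_mul_inner_weightedAverage (z : ℕ → Vec n) (K : ℕ) (v y : Vec n) :
    (∑ k ∈ Finset.range (K + 1), stepsize 1 k) * ⟪v, weightedAverage (stepsize 1) z K - y⟫ =
      ∑ k ∈ Finset.range (K + 1), stepsize 1 k * ⟪v, z k - y⟫ := by
  have hW := (sum_stepsize_pos K).ne'
  simp only [weightedAverage, inner_sub_right, inner_smul_right, inner_sum, mul_sub,
    Finset.sum_sub_distrib, ← Finset.sum_mul]
  rw [mul_inv_cancel_left₀ hW]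

theorem sum_mul_weightedAverage_le {φ : Vec n → ℝ} (hφ : ConvexOn ℝ X φ)
    {z : ℕ → Vec n} (hz : ∀ k, z k ∈ X) (K : ℕ) :
    (∑ k ∈ Finset.range (K + 1), stepsize 1 k) * φ (weightedAverage (stepsize 1) z K) ≤
      ∑ k ∈ Finset.range (K + 1), stepsize 1 k * φ (z k) := by
  have hW := sum_stepsize_pos K
  have h1 := hφ.map_sum_le (t := Finset.range (K + 1))
    (w := fun k => (∑ k ∈ Finset.range (K + 1), stepsize 1 k)⁻¹ * stepsize 1 k) (p := z)
    (fun k _ => mul_nonneg (inv_nonneg.2 hW.le) (stepsize_one_pos k).le)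
    (by rw [← Finset.mul_sum, inv_mul_cancel₀ hW.ne']) fun k _ => hz k
  simp only [smul_eq_mul, mul_assoc, ← Finset.mul_sum, mul_smul, ← Finset.smul_sum] at h1
  have h2 := mul_le_mul_of_nonneg_left h1 hW.le
  rwa [mul_inv_cancel_left₀ hW.ne'] at h2

/-- The maximizing y depends on the samples, so noise paired with it need not average out. Hence
⟨e_k, x_k - y⟩ is split: the part with x_k has mean zero, and the part with y is bounded by
Cauchy–Schwarz uniformly in y. -/
theorem IsRun.sum_mul_dualGap_le (hprob : ProblemAssumptions X F D f) (hρ : 0 < ρ) (hγ : 0 < γ)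
    (hr : IsRun X D f G (stepsize ρ) (stepsize γ) ξ j x₀ x lam g) (hx₀ : x₀ ∈ X)
    (hMX : ∀ x ∈ X, ‖x‖ ≤ M)
    (hMF : ∀ x ∈ X, ‖F x‖ ≤ M) (hMf : ∀ j, ∀ x ∈ X, |f j x| ≤ M)
    (hMg : ∀ j, ∀ x ∈ X, ∀ g ∈ subdifferential (D j) (f j) x, ‖g‖ ≤ M)
    (hT : ∀ k, stepsize 1 k ^ 2 ≤ T) (K : ℕ) (ω : Ω) :
    (∑ k ∈ Finset.range (K + 1), stepsize 1 k) *
        dualGap (feasible X f) F (weightedAverage (stepsize 1) (fun k => x k ω) K) ≤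
      2 * M ^ 2 / γ +
        ∑ k ∈ Finset.range (K + 1), γ / 2 * stepsize 1 k ^ 2 *
          directionBound M T ρ F G ξ x lam k ω +
        ∑ k ∈ Finset.range (K + 1), -stepsize 1 k * ⟪noise F G ξ x k ω, x k ω - 0⟫ +
        M * ‖∑ k ∈ Finset.range (K + 1), stepsize 1 k • noise F G ξ x k ω‖ := by
  have hW := sum_stepsize_pos K
  rw [mul_comm, ← le_div_iff₀ hW]
  refine (dualGap_isLUB hprob _).2 ?_
  rintro _ ⟨y, hy, rfl⟩
  simp only
  rw [le_div_iff₀ hW, mul_comm, sum_mul_inner_weightedAverage]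
  have hmono : ∑ k ∈ Finset.range (K + 1), stepsize 1 k * ⟪F y, x k ω - y⟫ ≤
      ∑ k ∈ Finset.range (K + 1), stepsize 1 k * ⟪F (x k ω), x k ω - y⟫ :=
    Finset.sum_le_sum fun k _ => mul_le_mul_of_nonneg_left (by
      have := hprob.monotone (x k ω) (hr.mem hx₀ k ω) y hy.1
      rw [inner_sub_left] at this
      linarith) (stepsize_one_pos k).le
  have hstep : ∀ N, ∑ k ∈ Finset.range N, stepsize 1 k * ⟪F (x k ω), x k ω - y⟫ ≤
      (energy ρ γ x lam y 0 0 ω - energy ρ γ x lam y 0 N ω) / 2 +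
        ∑ k ∈ Finset.range N, γ / 2 * stepsize 1 k ^ 2 * directionBound M T ρ F G ξ x lam k ω +
        ∑ k ∈ Finset.range N, -stepsize 1 k * ⟪noise F G ξ x k ω, x k ω - 0⟫ +
        ⟪∑ k ∈ Finset.range N, stepsize 1 k • noise F G ξ x k ω, y⟫ := by
    intro N
    induction N with
    | zero => simp
    | succ N ih =>
      -- With zero multipliers both the constraint term and the index noise disappear.
      have h1 := hr.energy_succ_le hprob hρ hγ hx₀ hMF hMf hMg hT hy (l := 0)
        (fun _ => le_rfl) N ω
      simp only [Pi.zero_apply, zero_mul, Finset.sum_const_zero, mul_zero, add_zero,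
        sub_zero] at h1
      simp only [Finset.sum_range_succ, inner_add_left, inner_smul_left, sub_zero] at ih ⊢
      rw [inner_sub_right (noise F G ξ x N ω)] at h1
      simp only [conj_trivial]
      linarith
  have hfin := hstep (K + 1)
  have h0 : energy ρ γ x lam y 0 0 ω ≤ (2 * M) ^ 2 / γ := by
    have : ‖x 0 ω - y‖ ≤ 2 * M :=
      (norm_sub_le _ _).trans (by linarith [hMX _ (hr.mem hx₀ 0 ω), hMX y hy.1])
    simp only [energy, hr.init_dual, Pi.zero_apply, sub_zero, ne_eq, OfNat.ofNat_ne_zero,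
      not_false_eq_true, zero_pow, Finset.sum_const_zero, zero_div, add_zero]
    gcongr
  have h1 : 0 ≤ energy ρ γ x lam y 0 (K + 1) ω := by
    unfold energy
    positivity
  have h2 : ⟪∑ k ∈ Finset.range (K + 1), stepsize 1 k • noise F G ξ x k ω, y⟫ ≤
      M * ‖∑ k ∈ Finset.range (K + 1), stepsize 1 k • noise F G ξ x k ω‖ := by
    refine (real_inner_le_norm _ _).trans ?_
    rw [mul_comm]
    exact mul_le_mul_of_nonneg_right (hMX y hy.1) (norm_nonneg _)
  have h3 : (2 * M) ^ 2 / γ = 2 * (2 * M ^ 2 / γ) := by ring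
  linarith

/-- Jensen bounds f_i at the average by the weighted mean of f_i(x_k), which the final multiplier
controls up to index noise. Where f_i is nonpositive, nonnegativity of the right side suffices. -/
theorem IsRun.sum_mul_infeasibility_le (hprob : ProblemAssumptions X F D f) (hρ : 0 < ρ)
    {gam : ℕ → ℝ} (hr : IsRun X D f G (stepsize ρ) gam ξ j x₀ x lam g) (hx₀ : x₀ ∈ X) (K : ℕ)
    (ω : Ω) :
    (∑ k ∈ Finset.range (K + 1), stepsize 1 k) *
        infeasibility f (weightedAverage (stepsize 1) (fun k => x k ω) K) ≤
      ∑ i, (lam (K + 1) ω i / ρ +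
        |∑ k ∈ Finset.range (K + 1), stepsize 1 k * indexNoise f j x i k ω|) := by
  have hW := sum_stepsize_pos K
  set W := ∑ k ∈ Finset.range (K + 1), stepsize 1 k
  set z := weightedAverage (stepsize 1) (fun k => x k ω) K with hz
  have hJ : 0 ≤ (J : ℝ)⁻¹ := by positivity
  have e : W * infeasibility f z = ∑ i, (J : ℝ)⁻¹ * (W * max (f i z) 0) := by
    rw [infeasibility, Finset.mul_sum, Finset.mul_sum]
    exact Finset.sum_congr rfl fun i _ => by ring
  rw [e]
  refine Finset.sum_le_sum fun i _ => ?_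
  have h0 : 0 ≤ lam (K + 1) ω i / ρ := div_nonneg (hr.lam_nonneg _ _ _) hρ.le
  have h1 := hr.sum_step_le_lam hρ i (K + 1) ω
  have h2 := mul_le_mul_of_nonneg_left (sum_mul_weightedAverage_le
    (hprob.convexOn_f i) (fun k => hr.mem hx₀ k ω) K) hJ
  have h3 := neg_abs_le (∑ k ∈ Finset.range (K + 1), stepsize 1 k * indexNoise f j x i k ω)
  rcases le_total (f i z) 0 with h | h
  · rw [max_eq_right h, mul_zero, mul_zero]
    exact add_nonneg h0 (abs_nonneg _)
  · rw [max_eq_left h]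
    linarith

variable [MeasurableSpace Ω] {P : Measure Ω} {μ : Measure S}

theorem measurable_weightedAverage (hprob : ProblemAssumptions X F D f)
    (hs : SamplingAssumptions P μ X F G ν ξ j) {rho gam : ℕ → ℝ}
    (hr : IsRun X D f G rho gam ξ j x₀ x lam g) (hx₀ : x₀ ∈ X) (K : ℕ) :
    Measurable fun ω => weightedAverage (stepsize 1) (fun k => x k ω) K := by
  have h1 : Measurable fun ω => ∑ k ∈ Finset.range (K + 1), stepsize 1 k • x k ω :=
    Finset.measurable_sum _ fun k _ => (((hr.measurable_past hprob hs hx₀ k).1.mono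
      (hs.past_le k) le_rfl).const_smul (stepsize 1 k))
  exact h1.const_smul (∑ k ∈ Finset.range (K + 1), stepsize 1 k)⁻¹

variable [IsProbabilityMeasure P]

theorem IsRun.sum_mul_integral_dualGap_le (hprob : ProblemAssumptions X F D f) (hρ : 0 < ρ)
    (hγ : 0 < γ) (hs : SamplingAssumptions P μ X F G ν ξ j)
    (hr : IsRun X D f G (stepsize ρ) (stepsize γ) ξ j x₀ x lam g) (hx₀ : x₀ ∈ X) (hM : 0 ≤ M)
    (hMX : ∀ x ∈ X, ‖x‖ ≤ M)
    (hMF : ∀ x ∈ X, ‖F x‖ ≤ M) (hMf : ∀ j, ∀ x ∈ X, |f j x| ≤ M)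
    (hMg : ∀ j, ∀ x ∈ X, ∀ g ∈ subdifferential (D j) (f j) x, ‖g‖ ≤ M)
    (hT : ∀ N, ∑ k ∈ Finset.range N, stepsize 1 k ^ 2 ≤ T)
    (hL : ∀ k, ∫ ω, ∑ i, lam k ω i ^ 2 ∂P ≤ L) (K : ℕ) :
    Integrable (fun ω => dualGap (feasible X f) F
      (weightedAverage (stepsize 1) (fun k => x k ω) K)) P ∧
    (∑ k ∈ Finset.range (K + 1), stepsize 1 k) * ∫ ω, dualGap (feasible X f) F
        (weightedAverage (stepsize 1) (fun k => x k ω) K) ∂P ≤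
      2 * M ^ 2 / γ + γ / 2 * T *
        (3 * M ^ 2 + 6 * M ^ 4 * ρ ^ 2 * T + 3 * ν ^ 2 + 6 * M ^ 2 * L) +
        M * (1 + ν ^ 2 * T) := by
  have hT0 : 0 ≤ T := by simpa using hT 0
  have hT1 : ∀ k, stepsize 1 k ^ 2 ≤ T := fun k =>
    (Finset.single_le_sum (f := fun i => stepsize 1 i ^ 2) (fun _ _ => sq_nonneg _)
      (Finset.self_mem_range_succ k)).trans (hT (k + 1))
  have hL0 : 0 ≤ L := le_trans
    (integral_nonneg fun ω => Finset.sum_nonneg fun i _ => sq_nonneg (lam 0 ω i)) (hL 0)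
  have hint : Integrable (fun ω => dualGap (feasible X f) F
      (weightedAverage (stepsize 1) (fun k => x k ω) K)) P :=
    integrable_comp_of_continuousOn hprob.compact hprob.continuous_dualGap.continuousOn
      (measurable_weightedAverage hprob hs hr hx₀ K)
      fun ω => weightedAverage_mem hprob.convex (fun k => hr.mem hx₀ k ω) K
  refine ⟨hint, ?_⟩
  have i1 : ∀ k, Integrable (fun ω => γ / 2 * stepsize 1 k ^ 2 *
      directionBound M T ρ F G ξ x lam k ω) P := fun k =>
    (integrable_directionBound hprob hρ hs hr hx₀ k).const_mul _
  have i1' : Integrable (fun ω => ∑ k ∈ Finset.range (K + 1), γ / 2 * stepsize 1 k ^ 2 *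
      directionBound M T ρ F G ξ x lam k ω) P := integrable_finsetSum _ fun k _ => i1 k
  have i2 : ∀ k, Integrable (fun ω => -stepsize 1 k * ⟪noise F G ξ x k ω, x k ω - 0⟫) P :=
    fun k => (integral_inner_noise_sub_eq_zero hprob hs hr hx₀ 0 k).1.const_mul _
  have i2' : Integrable (fun ω => ∑ k ∈ Finset.range (K + 1),
      -stepsize 1 k * ⟪noise F G ξ x k ω, x k ω - 0⟫) P := integrable_finsetSum _ fun k _ => i2 k
  obtain ⟨i3, b3⟩ := integral_norm_sum_noise_le hprob hs hr hx₀ hT (K + 1)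
  have i01 : Integrable (fun ω => 2 * M ^ 2 / γ + ∑ k ∈ Finset.range (K + 1),
      γ / 2 * stepsize 1 k ^ 2 * directionBound M T ρ F G ξ x lam k ω) P :=
    (integrable_const _).add i1'
  have i012 : Integrable (fun ω => 2 * M ^ 2 / γ + ∑ k ∈ Finset.range (K + 1),
      γ / 2 * stepsize 1 k ^ 2 * directionBound M T ρ F G ξ x lam k ω +
      ∑ k ∈ Finset.range (K + 1), -stepsize 1 k * ⟪noise F G ξ x k ω, x k ω - 0⟫) P :=
    i01.add i2'
  have h1 := integral_mono (hint.const_mul _) (i012.add (i3.const_mul M))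
    fun ω => hr.sum_mul_dualGap_le hprob hρ hγ hx₀ hMX hMF hMf hMg hT1 K ω
  have e1 := integral_add i012 (i3.const_mul M)
  rw [integral_add i01 i2', integral_add (integrable_const _) i1', integral_const,
    probReal_univ, one_smul, integral_finsetSum _ fun k _ => i1 k,
    integral_finsetSum _ fun k _ => i2 k, integral_const_mul] at e1
  rw [integral_const_mul] at h1
  have z2 : ∑ k ∈ Finset.range (K + 1),
      ∫ ω, -stepsize 1 k * ⟪noise F G ξ x k ω, x k ω - 0⟫ ∂P = 0 :=
    Finset.sum_eq_zero fun k _ => by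
      rw [integral_const_mul, (integral_inner_noise_sub_eq_zero hprob hs hr hx₀ 0 k).2, mul_zero]
  have b1 : ∑ k ∈ Finset.range (K + 1), ∫ ω, γ / 2 * stepsize 1 k ^ 2 *
      directionBound M T ρ F G ξ x lam k ω ∂P ≤ γ / 2 * T *
        (3 * M ^ 2 + 6 * M ^ 4 * ρ ^ 2 * T + 3 * ν ^ 2 + 6 * M ^ 2 * L) := by
    set c := 3 * M ^ 2 + 6 * M ^ 4 * ρ ^ 2 * T + 3 * ν ^ 2 + 6 * M ^ 2 * L with hc
    have hc0 : 0 ≤ c := by positivity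
    calc _ ≤ ∑ k ∈ Finset.range (K + 1), γ / 2 * stepsize 1 k ^ 2 * c := by
          refine Finset.sum_le_sum fun k _ => ?_
          rw [integral_const_mul]
          refine mul_le_mul_of_nonneg_left ?_ (by positivity)
          refine (integral_directionBound_le hprob hρ hs hr hx₀ k).trans ?_
          have := mul_le_mul_of_nonneg_left (hL k) (by positivity : 0 ≤ 6 * M ^ 2)
          linarith
      _ = γ / 2 * (∑ k ∈ Finset.range (K + 1), stepsize 1 k ^ 2) * c := by
          rw [← Finset.sum_mul, ← Finset.mul_sum]
      _ ≤ _ := by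
          have := hT (K + 1)
          gcongr
  have b3' := mul_le_mul_of_nonneg_left b3 hM
  refine (h1.trans (le_of_eq e1)).trans ?_
  rw [z2]
  linarith

theorem IsRun.sum_mul_integral_infeasibility_le (hprob : ProblemAssumptions X F D f)
    (hρ : 0 < ρ) (hs : SamplingAssumptions P μ X F G ν ξ j) {gam : ℕ → ℝ}
    (hr : IsRun X D f G (stepsize ρ) gam ξ j x₀ x lam g) (hx₀ : x₀ ∈ X)
    (hMf : ∀ j, ∀ x ∈ X, |f j x| ≤ M)
    (hT : ∀ N, ∑ k ∈ Finset.range N, stepsize 1 k ^ 2 ≤ T)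
    (hL : ∀ k, ∫ ω, ∑ i, lam k ω i ^ 2 ∂P ≤ L) (K : ℕ) :
    Integrable (fun ω => infeasibility f
      (weightedAverage (stepsize 1) (fun k => x k ω) K)) P ∧
    (∑ k ∈ Finset.range (K + 1), stepsize 1 k) * ∫ ω, infeasibility f
        (weightedAverage (stepsize 1) (fun k => x k ω) K) ∂P ≤
      J * ((1 + L) / ρ + (1 + M ^ 2 * T)) := by
  have hint : Integrable (fun ω => infeasibility f
      (weightedAverage (stepsize 1) (fun k => x k ω) K)) P :=
    integrable_comp_of_continuousOn hprob.compact hprob.continuousOn_infeasibility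
      (measurable_weightedAverage hprob hs hr hx₀ K)
      fun ω => weightedAverage_mem hprob.convex (fun k => hr.mem hx₀ k ω) K
  refine ⟨hint, ?_⟩
  have hm := memLp_dual hprob hρ hs hr hx₀ (K + 1)
  have i1 : ∀ i, Integrable (fun ω => lam (K + 1) ω i / ρ) P := fun i =>
    ((hm i).integrable one_le_two).div_const ρ
  have h2 := fun i => integral_abs_sum_indexNoise_le hprob hs hr hx₀ hMf hT i (K + 1)
  have i12 : ∀ i, Integrable (fun ω => lam (K + 1) ω i / ρ +
      |∑ k ∈ Finset.range (K + 1), stepsize 1 k * indexNoise f j x i k ω|) P :=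
    fun i => (i1 i).add (h2 i).1
  have h1 := integral_mono (hint.const_mul _) (integrable_finsetSum _ fun i _ => i12 i)
    fun ω => hr.sum_mul_infeasibility_le hprob hρ hx₀ K ω
  rw [integral_const_mul, integral_finsetSum _ fun i _ => i12 i] at h1
  refine h1.trans ?_
  calc _ ≤ ∑ _i : Fin J, ((1 + L) / ρ + (1 + M ^ 2 * T)) := by
        refine Finset.sum_le_sum fun i _ => ?_
        rw [integral_add (i1 i) (h2 i).1, integral_div]
        refine add_le_add (div_le_div_of_nonneg_right ?_ hρ.le) (h2 i).2
        have h3 : ∫ ω, ‖lam (K + 1) ω i‖ ^ 2 ∂P ≤ L := by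
          refine le_trans (integral_mono ((hm i).integrable_norm_pow two_ne_zero)
            (integrable_finsetSum _ fun i _ => (hm i).integrable_sq) fun ω => ?_) (hL (K + 1))
          change ‖lam (K + 1) ω i‖ ^ 2 ≤ ∑ i, lam (K + 1) ω i ^ 2
          rw [Real.norm_eq_abs, sq_abs]
          exact Finset.single_le_sum (f := fun i => lam (K + 1) ω i ^ 2)
            (fun _ _ => sq_nonneg _) (Finset.mem_univ i)
        refine le_trans (integral_mono ((hm i).integrable one_le_two)
          ((hm i).integrable one_le_two).norm fun ω => le_abs_self _)
          (integral_norm_le_of_sq_le (hm i) h3)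
    _ = _ := by rw [Finset.sum_const, Finset.card_univ, Fintype.card_fin, nsmul_eq_mul]

end Rate

end RLSA

/-! ### Assembling the constant -/

theorem mainTheorem1 {n J : ℕ} (hJ : 0 < J)
    (X : Set (RLSA.Vec n)) (F : RLSA.Vec n → RLSA.Vec n)
    (D : Fin J → Set (RLSA.Vec n)) (f : Fin J → RLSA.Vec n → ℝ)
    (hprob : RLSA.ProblemAssumptions X F D f)
    (ν : ℝ) (hν : 0 < ν) (ρ γ : ℝ) (hρ : 0 < ρ) (hγ : 0 < γ) :
    ∃ C : ℝ,
      ∀ (S Ω : Type*) [MeasurableSpace S] [MeasurableSpace Ω]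
        (P : Measure Ω) [IsProbabilityMeasure P] (μ : Measure S)
        (G : RLSA.Vec n → S → RLSA.Vec n) (ξ : ℕ → Ω → S) (j : ℕ → Ω → Fin J),
        RLSA.SamplingAssumptions P μ X F G ν ξ j →
        ∀ x₀ ∈ X, ∀ (x : ℕ → Ω → RLSA.Vec n) (lam : ℕ → Ω → Fin J → ℝ)
          (g : ℕ → Ω → RLSA.Vec n),
          RLSA.IsRun X D f G (RLSA.stepsize ρ) (RLSA.stepsize γ) ξ j x₀ x lam g →
          ∀ K : ℕ, 1 ≤ K →
            (Integrable (fun ω => RLSA.dualGap (RLSA.feasible X f) F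
                (RLSA.weightedAverage (RLSA.stepsize 1) (fun k => x k ω) K)) P ∧
              ∫ ω, RLSA.dualGap (RLSA.feasible X f) F
                (RLSA.weightedAverage (RLSA.stepsize 1) (fun k => x k ω) K) ∂P ≤
                C * (Real.log ((K : ℝ) + 1) / √((K : ℝ) + 2))) ∧
            (Integrable (fun ω => RLSA.infeasibility f
                (RLSA.weightedAverage (RLSA.stepsize 1) (fun k => x k ω) K)) P ∧
              ∫ ω, RLSA.infeasibility f
                (RLSA.weightedAverage (RLSA.stepsize 1) (fun k => x k ω) K) ∂P ≤
                C * (Real.log ((K : ℝ) + 1) / √((K : ℝ) + 2))) := by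
  obtain ⟨M, hM, hMX, hMF, hMf, hMg⟩ := hprob.exists_bound
  obtain ⟨T, -, hT⟩ := RLSA.exists_sum_stepsize_sq_le
  -- The saddle point, like M and T, is fixed before the probability space and the run are
  -- introduced, so the constant cannot depend on them.
  obtain ⟨y, hyX, l, hl, hfy, hyl⟩ := hprob.exists_saddle
  set L := RLSA.dualBound M T ρ γ ν fun i => J * l i
  set C₁ := 2 * M ^ 2 / γ + γ / 2 * T *
    (3 * M ^ 2 + 6 * M ^ 4 * ρ ^ 2 * T + 3 * ν ^ 2 + 6 * M ^ 2 * L) + M * (1 + ν ^ 2 * T)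
  set C₂ := (J : ℝ) * ((1 + L) / ρ + (1 + M ^ 2 * T))
  -- The 3 comes from `inv_sum_stepsize_le`; absolute values give a common nonnegative bound for
  -- both errors.
  refine ⟨3 * (|C₁| + |C₂|), ?_⟩
  intro S Ω _ _ P _ μ G ξ j hs x₀ hx₀ x lam g hr K hK
  have hL := RLSA.integral_dual_sq_le hprob hJ hρ hγ hs hr hx₀ hMX hMF hMf hMg hT
    ⟨hyX, hfy⟩ hl hyl
  obtain ⟨i₁, h₁⟩ :=
    hr.sum_mul_integral_dualGap_le hprob hρ hγ hs hx₀ hM hMX hMF hMf hMg hT hL K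
  obtain ⟨i₂, h₂⟩ := hr.sum_mul_integral_infeasibility_le hprob hρ hs hx₀ hMf hT hL K
  have hW := RLSA.sum_stepsize_pos K
  have key : ∀ {a c : ℝ}, (∑ k ∈ Finset.range (K + 1), RLSA.stepsize 1 k) * a ≤ c →
      c ≤ |C₁| + |C₂| →
      a ≤ 3 * (|C₁| + |C₂|) * (Real.log ((K : ℝ) + 1) / √((K : ℝ) + 2)) := by
    intro a c hac hc
    calc a = (∑ k ∈ Finset.range (K + 1), RLSA.stepsize 1 k)⁻¹ *
          ((∑ k ∈ Finset.range (K + 1), RLSA.stepsize 1 k) * a) := by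
          rw [inv_mul_cancel_left₀ hW.ne']
      _ ≤ (∑ k ∈ Finset.range (K + 1), RLSA.stepsize 1 k)⁻¹ * (|C₁| + |C₂|) :=
          mul_le_mul_of_nonneg_left (hac.trans hc) (inv_nonneg.2 hW.le)
      _ ≤ 3 * (Real.log ((K : ℝ) + 1) / √((K : ℝ) + 2)) * (|C₁| + |C₂|) :=
          mul_le_mul_of_nonneg_right (RLSA.inv_sum_stepsize_le K hK) (by positivity)
      _ = _ := by ring
  exact ⟨⟨i₁, key h₁ ((le_abs_self C₁).trans (le_add_of_nonneg_right (abs_nonneg C₂)))⟩,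
    ⟨i₂, key h₂ ((le_abs_self C₂).trans (le_add_of_nonneg_left (abs_nonneg C₁)))⟩⟩
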